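/- Let $A:\mathbb R\to\mathbb R$ be infinitely differentiable, vanishing exponentially fast at $+\infty$ (there is $c>0$ with $A(x)=O(e^{-cx})$ as $x\to+\infty$), and satisfying the orthogonality relation $\int_{\mathbb R}A(r+x)A(r+y)\,dr=\delta(x-y)$ in the sense of distributions, i.e. for all $\varphi,\psi\in C_c^\infty(\mathbb R)$ the function $r\mapsto\big(\int A(r+x)\varphi(x)dx\big)\big(\int A(r+y)\psi(y)dy\big)$ is integrable on $\mathbb R$ with integral $\int\varphi\psi$. For $s\in\mathbb R$ let $A_s$ and $K_s$ be the integral operators on $L^2(\mathbb R_+)$ with kernels $$A_s(x,y)=A(x+y+s),\qquad K_s(x,y)=\int_0^\infty A(x+r+s)A(y+r+s)\,dr ,$$ and let $$\mathrm{Det}(I-K_s)=1+\sum_{n\ge1}\frac{(-1)^n}{n!}\int_{\mathbb R_+^n}\det\big[K_s(x_i,x_j)\big]_{i,j=1}^n\,dx_1\cdots dx_n .$$ Then for every $s\in\mathbb R$ the operator $I-K_s$ is invertible on $L^2(\mathbb R_+)$, the integrals and the series defining $\mathrm{Det}(I-K_s)$ converge absolutely, and $\mathrm{Det}(I-K_s)>0$.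 Define $$u_0(s)=\iint_{\mathbb R_+^2}A(s+y)\,(I-K_s)^{-1}(y,z)\,A(z+s)\,dy\,dz=\big\langle a_s,(I-K_s)^{-1}a_s\big\rangle_{L^2(\mathbb R_+)},$$ $$q_0(s)=\int_{\mathbb R_+}A(s+y)\,(I-K_s)^{-1}(y,0)\,dy=A(s)+\big\langle a_s,(I-K_s)^{-1}K_s(\cdot,0)\big\rangle_{L^2(\mathbb R_+)},$$ where $a_s(x)=A(x+s)$ and $(I-K_s)^{-1}(y,0)=\delta(y)+\big((I-K_s)^{-1}K_s(\cdot,0)\big)(y)$, the point mass at $y=0$ being counted fully. Then $s\mapsto\log\mathrm{Det}(I-K_s)$ is twice differentiable on $\mathbb R$, and for every $s\in\mathbb R$ $$\partial_s\log\mathrm{Det}(I-K_s)=u_0(s),\qquad \partial_s^2\log\mathrm{Det}(I-K_s)=-q_0(s)^2 .$$ Moreover $u_0$ is integrable on $(s,\infty)$ and $$\mathrm{Det}(I-K_s)=\exp\Big(-\int_s^{\infty}u_0(t)\,dt\Big).$$ -/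

import Mathlib

open MeasureTheory Set Filter
open scoped ContDiff ENNReal

noncomputable section

namespace TauRep

/-- Lebesgue measure on the half-line `ℝ₊ = (0, ∞)`. -/
abbrev halfLine : Measure ℝ := volume.restrict (Ioi (0 : ℝ))

/-- The real Hilbert space `L²(ℝ₊)`. -/
abbrev L2 : Type := Lp ℝ 2 halfLine

/-- The kernel `A_s(x, y) = A(x + y + s)`. -/
def aKernel (A : ℝ → ℝ) (s x y : ℝ) : ℝ := A (x + y + s)

/-- The kernel `K_s(x, y) = ∫₀^∞ A(x + r + s) A(y + r + s) dr`. -/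
def kKernel (A : ℝ → ℝ) (s x y : ℝ) : ℝ :=
  ∫ r in Ioi (0 : ℝ), aKernel A s x r * aKernel A s y r

/-- Standing assumptions on `A : ℝ → ℝ`: it is infinitely differentiable, it vanishes
exponentially fast at `+∞`, and `∫ A(r + x) A(r + y) dr = δ(x - y)` as distributions in `(x, y)`. -/
structure Admissible (A : ℝ → ℝ) : Prop where
  smooth : ContDiff ℝ ∞ A
  decay : ∃ c : ℝ, 0 < c ∧ A =O[atTop] fun x => Real.exp (-c * x)
  orthogonal : ∀ φ ψ : ℝ → ℝ, ContDiff ℝ ∞ φ → HasCompactSupport φ →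
    ContDiff ℝ ∞ ψ → HasCompactSupport ψ →
    Integrable (fun r : ℝ => (∫ x, A (r + x) * φ x) * ∫ y, A (r + y) * ψ y) ∧
      ∫ r : ℝ, (∫ x, A (r + x) * φ x) * (∫ y, A (r + y) * ψ y) = ∫ x, φ x * ψ x

/-! ### Hilbert–Schmidt integral operators on `L²(ℝ₊)` -/

section HilbertSchmidt

variable {k : ℝ → ℝ → ℝ}

theorem aestronglyMeasurable_kernel_integral
    (hk : MemLp (Function.uncurry k) 2 (halfLine.prod halfLine)) (f : L2) :
    AEStronglyMeasurable (fun x => ∫ y, k x y * f y ∂halfLine) halfLine := by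
  have h : AEStronglyMeasurable (fun p : ℝ × ℝ => k p.1 p.2 * f p.2)
      (halfLine.prod halfLine) :=
    hk.1.mul (Lp.aestronglyMeasurable f).comp_snd
  exact h.integral_prod_right'

theorem eLpNorm_kernel_integral_le
    (hk : MemLp (Function.uncurry k) 2 (halfLine.prod halfLine)) (f : L2) :
    eLpNorm (fun x => ∫ y, k x y * f y ∂halfLine) 2 halfLine ≤
      eLpNorm (Function.uncurry k) 2 (halfLine.prod halfLine) * eLpNorm f 2 halfLine := by
  have e2 : ∀ {α : Type} [MeasurableSpace α] (ν : Measure α) (g : α → ℝ),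
      eLpNorm g 2 ν = (∫⁻ x, ‖g x‖ₑ ^ (2 : ℝ) ∂ν) ^ (1 / 2 : ℝ) := by
    intro α _ ν g
    rw [eLpNorm_eq_lintegral_rpow_enorm_toReal (by norm_num) (by norm_num)]
    norm_num
  have hx : ∀ᵐ x ∂halfLine, AEStronglyMeasurable (fun y => k x y) halfLine :=
    hk.1.prodMk_left
  have hpt : ∀ᵐ x ∂halfLine, ‖∫ y, k x y * f y ∂halfLine‖ₑ ^ (2 : ℝ) ≤
      (∫⁻ y, ‖k x y‖ₑ ^ (2 : ℝ) ∂halfLine) * ∫⁻ y, ‖f y‖ₑ ^ (2 : ℝ) ∂halfLine := by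
    filter_upwards [hx] with x hx
    have h1 : ‖∫ y, k x y * f y ∂halfLine‖ₑ ≤ ∫⁻ y, ‖k x y‖ₑ * ‖f y‖ₑ ∂halfLine := by
      refine (enorm_integral_le_lintegral_enorm _).trans (le_of_eq ?_)
      simp only [enorm_mul]
    have h2 := ENNReal.lintegral_mul_le_Lp_mul_Lq halfLine
      (Real.HolderConjugate.two_two) hx.enorm (Lp.aestronglyMeasurable f).enorm
    have h3 := ENNReal.rpow_le_rpow (h1.trans h2) (z := 2) (by norm_num)
    refine h3.trans (le_of_eq ?_)
    rw [ENNReal.mul_rpow_of_nonneg _ _ (by norm_num), ← ENNReal.rpow_mul, ← ENNReal.rpow_mul]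
    norm_num
  rw [e2, e2, e2, ← ENNReal.mul_rpow_of_nonneg _ _ (by norm_num)]
  refine ENNReal.rpow_le_rpow ?_ (by norm_num)
  refine (lintegral_mono_ae hpt).trans ?_
  rw [lintegral_mul_const'' _ ?_]
  · rw [lintegral_prod _ (hk.1.enorm.pow_const _)]
    rfl
  · exact (hk.1.enorm.pow_const (2 : ℝ)).lintegral_prod_right'

theorem memLp_kernel_integral
    (hk : MemLp (Function.uncurry k) 2 (halfLine.prod halfLine)) (f : L2) :
    MemLp (fun x => ∫ y, k x y * f y ∂halfLine) 2 halfLine :=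
  ⟨aestronglyMeasurable_kernel_integral hk f,
    (eLpNorm_kernel_integral_le hk f).trans_lt
      (ENNReal.mul_lt_top hk.2 (Lp.memLp f).2)⟩

theorem ae_integrable_kernel_mul
    (hk : MemLp (Function.uncurry k) 2 (halfLine.prod halfLine)) (f : L2) :
    ∀ᵐ x ∂halfLine, Integrable (fun y => k x y * f y) halfLine := by
  have hsq : Integrable (fun p : ℝ × ℝ => (Function.uncurry k p) ^ 2)
      (halfLine.prod halfLine) := hk.integrable_sq
  filter_upwards [hsq.prod_right_ae, hk.1.prodMk_left] with x h1 h2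
  have h3 : MemLp (fun y => k x y) 2 halfLine := (memLp_two_iff_integrable_sq h2).2 h1
  exact h3.integrable_mul (Lp.memLp f)

/-- The Hilbert–Schmidt operator on `L²(ℝ₊)` with kernel `k`:
`(T f)(x) = ∫₀^∞ k(x, y) f(y) dy`. -/
def kernelOperator (k : ℝ → ℝ → ℝ)
    (hk : MemLp (Function.uncurry k) 2 (halfLine.prod halfLine)) : L2 →L[ℝ] L2 :=
  LinearMap.mkContinuous
    { toFun := fun f => (memLp_kernel_integral hk f).toLp _
      map_add' := by
        intro f g
        rw [← MemLp.toLp_add]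
        refine MemLp.toLp_congr _ _ ?_
        filter_upwards [ae_integrable_kernel_mul hk f, ae_integrable_kernel_mul hk g]
          with x hf hg
        rw [Pi.add_apply, ← integral_add hf hg]
        refine integral_congr_ae ?_
        filter_upwards [Lp.coeFn_add f g] with y hy
        rw [hy, Pi.add_apply, mul_add]
      map_smul' := by
        intro c f
        rw [RingHom.id_apply, ← MemLp.toLp_const_smul]
        refine MemLp.toLp_congr _ _ (ae_of_all _ fun x => ?_)
        rw [Pi.smul_apply, ← integral_smul]
        refine integral_congr_ae ?_
        filter_upwards [Lp.coeFn_smul c f] with y hy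
        rw [hy, Pi.smul_apply, smul_eq_mul, smul_eq_mul]
        ring }
    (eLpNorm (Function.uncurry k) 2 (halfLine.prod halfLine)).toReal
    (by
      intro f
      change ‖(memLp_kernel_integral hk f).toLp _‖ ≤ _
      rw [Lp.norm_toLp, Lp.norm_def, ← ENNReal.toReal_mul]
      exact ENNReal.toReal_mono (ENNReal.mul_lt_top hk.2 (Lp.memLp f).2).ne
        (eLpNorm_kernel_integral_le hk f))

theorem kernelOperator_apply_ae
    (hk : MemLp (Function.uncurry k) 2 (halfLine.prod halfLine)) (f : L2) :
    kernelOperator k hk f =ᵐ[halfLine] fun x => ∫ y in Ioi (0 : ℝ), k x y * f y :=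
  MemLp.coeFn_toLp (memLp_kernel_integral hk f)

end HilbertSchmidt

/-! ### Square integrability of the objects attached to `A` -/

section Integrability

variable {A : ℝ → ℝ}

theorem Admissible.exists_bound (hA : Admissible A) (s : ℝ) :
    ∃ C c : ℝ, 0 < C ∧ 0 < c ∧ ∀ x, 0 ≤ x → |A (x + s)| ≤ C * Real.exp (-c * x) := by
  obtain ⟨c, hc, hO⟩ := hA.decay
  obtain ⟨C, hC⟩ := hO.bound
  obtain ⟨N, hN⟩ := eventually_atTop.1 hC
  obtain ⟨M, hM⟩ := (isCompact_Icc (a := s) (b := max N s)).exists_bound_of_continuousOn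
    hA.smooth.continuous.continuousOn
  refine ⟨|C| * Real.exp (-c * s) + |M| * Real.exp (c * (max N s - s)) + 1, c,
    by positivity, hc, fun x hx => ?_⟩
  have p1 : 0 ≤ |C| * Real.exp (-c * s) * Real.exp (-c * x) := by positivity
  have p2 : 0 ≤ |M| * Real.exp (c * (max N s - s)) * Real.exp (-c * x) := by positivity
  have p3 : 0 < Real.exp (-c * x) := Real.exp_pos _
  rcases le_total N (x + s) with h | h
  · have h1 := hN _ h
    rw [Real.norm_eq_abs, Real.norm_eq_abs, Real.abs_exp] at h1
    have h2 : C * Real.exp (-c * (x + s)) ≤ |C| * Real.exp (-c * s) * Real.exp (-c * x) := by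
      rw [mul_assoc, ← Real.exp_add]
      have : -c * s + -c * x = -c * (x + s) := by ring
      rw [this]
      exact mul_le_mul_of_nonneg_right (le_abs_self C) (Real.exp_pos _).le
    nlinarith
  · have h1 := hM (x + s) ⟨by linarith, h.trans (le_max_left _ _)⟩
    rw [Real.norm_eq_abs] at h1
    have h2 : |M| ≤ |M| * Real.exp (c * (max N s - s)) * Real.exp (-c * x) := by
      rw [mul_assoc, ← Real.exp_add]
      refine le_mul_of_one_le_right (abs_nonneg M) (Real.one_le_exp ?_)
      have : x + s ≤ max N s := h.trans (le_max_left _ _)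
      nlinarith
    have := le_abs_self M
    nlinarith

theorem continuous_aKernel (hA : Admissible A) (s : ℝ) :
    Continuous fun p : ℝ × ℝ => aKernel A s p.1 p.2 := by
  have := hA.smooth.continuous
  unfold aKernel
  fun_prop

theorem stronglyMeasurable_kKernel (hA : Admissible A) (s : ℝ) :
    StronglyMeasurable (Function.uncurry (kKernel A s)) := by
  have hc := hA.smooth.continuous
  have h : StronglyMeasurable
      (fun p : (ℝ × ℝ) × ℝ => aKernel A s p.1.1 p.2 * aKernel A s p.1.2 p.2) := by
    unfold aKernel
    exact (by fun_prop : Continuous _).stronglyMeasurable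
  exact h.integral_prod_right' (ν := halfLine)

theorem Admissible.exists_kKernel_bound (hA : Admissible A) (s : ℝ) :
    ∃ C c : ℝ, 0 < C ∧ 0 < c ∧ ∀ x y, 0 ≤ x → 0 ≤ y →
      |kKernel A s x y| ≤ C * (Real.exp (-c * x) * Real.exp (-c * y)) := by
  obtain ⟨C, c, hC, hc, hb⟩ := hA.exists_bound s
  refine ⟨C ^ 2 * (∫ r in Ioi (0 : ℝ), Real.exp (-(2 * c) * r)) + 1, c, ?_, hc,
    fun x y hx hy => ?_⟩
  · have : 0 ≤ ∫ r in Ioi (0 : ℝ), Real.exp (-(2 * c) * r) :=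
      integral_nonneg fun r => (Real.exp_pos _).le
    positivity
  have hint : IntegrableOn (fun r : ℝ => C ^ 2 * (Real.exp (-c * x) * Real.exp (-c * y)) *
      Real.exp (-(2 * c) * r)) (Ioi 0) :=
    (exp_neg_integrableOn_Ioi 0 (by positivity : 0 < 2 * c)).const_mul _
  have h1 : |kKernel A s x y| ≤ ∫ r in Ioi (0 : ℝ),
      C ^ 2 * (Real.exp (-c * x) * Real.exp (-c * y)) * Real.exp (-(2 * c) * r) := by
    rw [← Real.norm_eq_abs]
    refine norm_integral_le_of_norm_le hint ?_
    filter_upwards [ae_restrict_mem measurableSet_Ioi] with r hr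
    have hr' : (0 : ℝ) ≤ r := (mem_Ioi.1 hr).le
    have b1 := hb (x + r) (by linarith)
    have b2 := hb (y + r) (by linarith)
    rw [Real.norm_eq_abs, abs_mul]
    refine (mul_le_mul b1 b2 (abs_nonneg _) (by positivity)).trans (le_of_eq ?_)
    have e : Real.exp (-c * (x + r)) * Real.exp (-c * (y + r)) =
        Real.exp (-c * x) * Real.exp (-c * y) * Real.exp (-(2 * c) * r) := by
      rw [← Real.exp_add, ← Real.exp_add, ← Real.exp_add]
      congr 1
      ring
    linear_combination C ^ 2 * e
  rw [integral_const_mul] at h1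
  have p : 0 < Real.exp (-c * x) * Real.exp (-c * y) := by positivity
  nlinarith

theorem memLp_exp {c : ℝ} (hc : 0 < c) :
    MemLp (fun x : ℝ => Real.exp (-c * x)) 2 halfLine := by
  refine (memLp_two_iff_integrable_sq (by fun_prop)).2 ?_
  have : (fun x : ℝ => Real.exp (-c * x) ^ 2) = fun x => Real.exp (-(2 * c) * x) := by
    funext x
    rw [← Real.exp_nat_mul]
    congr 1
    push_cast
    ring
  rw [this]
  exact exp_neg_integrableOn_Ioi 0 (by positivity : 0 < 2 * c)

theorem memLp_aKernel_zero (hA : Admissible A) (s : ℝ) :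
    MemLp (fun x => aKernel A s x 0) 2 halfLine := by
  obtain ⟨C, c, hC, hc, hb⟩ := hA.exists_bound s
  refine ((memLp_exp hc).const_mul C).mono' ?_ ?_
  · exact ((continuous_aKernel hA s).comp (by fun_prop :
      Continuous fun x : ℝ => (x, (0 : ℝ)))).aestronglyMeasurable
  · filter_upwards [ae_restrict_mem measurableSet_Ioi] with x hx
    simpa [aKernel] using hb x (mem_Ioi.1 hx).le

theorem memLp_kKernel_zero (hA : Admissible A) (s : ℝ) :
    MemLp (fun x => kKernel A s x 0) 2 halfLine := by
  obtain ⟨C, c, hC, hc, hb⟩ := hA.exists_kKernel_bound s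
  refine ((memLp_exp hc).const_mul C).mono' ?_ ?_
  · exact ((stronglyMeasurable_kKernel hA s).comp_measurable (by fun_prop :
      Measurable fun x : ℝ => (x, (0 : ℝ)))).aestronglyMeasurable
  · filter_upwards [ae_restrict_mem measurableSet_Ioi] with x hx
    simpa using hb x 0 (mem_Ioi.1 hx).le le_rfl

theorem memLp_kKernel (hA : Admissible A) (s : ℝ) :
    MemLp (Function.uncurry (kKernel A s)) 2 (halfLine.prod halfLine) := by
  obtain ⟨C, c, hC, hc, hb⟩ := hA.exists_kKernel_bound s
  have hprod : MemLp (fun p : ℝ × ℝ => Real.exp (-c * p.1) * Real.exp (-c * p.2)) 2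
      (halfLine.prod halfLine) := by
    refine (memLp_two_iff_integrable_sq (by fun_prop)).2 ?_
    have h := (memLp_exp hc).integrable_sq
    simpa only [mul_pow] using h.mul_prod h
  refine (hprod.const_mul C).mono' (stronglyMeasurable_kKernel hA s).aestronglyMeasurable ?_
  rw [Measure.prod_restrict]
  filter_upwards [ae_restrict_mem (measurableSet_Ioi.prod measurableSet_Ioi)] with p hp
  exact hb p.1 p.2 (mem_Ioi.1 hp.1).le (mem_Ioi.1 hp.2).le

end Integrability

/-! ### The Fredholm determinant and the functions `u₀`, `q₀` -/

/-- The `n`-th integral `∫_{ℝ₊ⁿ} det [k(xᵢ, xⱼ)] dx₁ ⋯ dxₙ` (it equals `1` for `n = 0`). -/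
def fredholmCoeff (k : ℝ → ℝ → ℝ) (n : ℕ) : ℝ :=
  ∫ x in Set.univ.pi (fun _ : Fin n => Ioi (0 : ℝ)),
    (Matrix.of fun i j : Fin n => k (x i) (x j)).det

/-- The Fredholm determinant `Det(I - k)` on `L²(ℝ₊)`, given by
`1 + ∑_{n ≥ 1} (-1)ⁿ/n! ∫_{ℝ₊ⁿ} det [k(xᵢ, xⱼ)] dx₁ ⋯ dxₙ`. -/
def fredholmDet (k : ℝ → ℝ → ℝ) : ℝ :=
  1 + ∑' n : ℕ, (-1) ^ (n + 1) / (Nat.factorial (n + 1) : ℝ) * fredholmCoeff k (n + 1)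

/-- The integrals and the series in the Fredholm determinant converge absolutely. -/
def FredholmSeriesConverges (k : ℝ → ℝ → ℝ) : Prop :=
  (∀ n : ℕ, IntegrableOn
    (fun x : Fin n → ℝ => (Matrix.of fun i j : Fin n => k (x i) (x j)).det)
    (Set.univ.pi fun _ : Fin n => Ioi (0 : ℝ))) ∧
  Summable fun n : ℕ => (-1) ^ (n + 1) / (Nat.factorial (n + 1) : ℝ) * fredholmCoeff k (n + 1)

/-- The operator `K_s` on `L²(ℝ₊)`. -/
def kOp {A : ℝ → ℝ} (hA : Admissible A) (s : ℝ) : L2 →L[ℝ] L2 :=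
  kernelOperator (kKernel A s) (memLp_kKernel hA s)

/-- `(I - K_s)⁻¹` in the algebra of bounded operators on `L²(ℝ₊)`. -/
def resolvent {A : ℝ → ℝ} (hA : Admissible A) (s : ℝ) : L2 →L[ℝ] L2 :=
  Ring.inverse (1 - kOp hA s)

/-- The function `A_s|δ⟩ : x ↦ A_s(x, 0) = A(x + s)` in `L²(ℝ₊)`. -/
def aVec {A : ℝ → ℝ} (hA : Admissible A) (s : ℝ) : L2 :=
  (memLp_aKernel_zero hA s).toLp (fun x => aKernel A s x 0)

/-- The function `K_s|δ⟩ : x ↦ K_s(x, 0)` in `L²(ℝ₊)`. -/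
def kVec {A : ℝ → ℝ} (hA : Admissible A) (s : ℝ) : L2 :=
  (memLp_kKernel_zero hA s).toLp (fun x => kKernel A s x 0)

/-- `u₀(s) = ⟨δ|A_s (I - K_s)⁻¹ A_s|δ⟩ = ∬ A(s + y) (I - K_s)⁻¹(y, z) A(z + s) dy dz`. -/
def u₀ {A : ℝ → ℝ} (hA : Admissible A) (s : ℝ) : ℝ :=
  inner ℝ (aVec hA s) (resolvent hA s (aVec hA s))

/-- `q₀(s) = ⟨δ|A_s (I - K_s)⁻¹|δ⟩ = ∫ A(s + y) (I - K_s)⁻¹(y, 0) dy`. Since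
`(I - K_s)⁻¹ = I + (I - K_s)⁻¹ K_s`, the distributional kernel is
`(I - K_s)⁻¹(y, 0) = δ(y) + ((I - K_s)⁻¹ K_s(·, 0))(y)`; the mass at `y = 0` contributes `A(s)`. -/
def q₀ {A : ℝ → ℝ} (hA : Admissible A) (s : ℝ) : ℝ :=
  A s + inner ℝ (aVec hA s) (resolvent hA s (kVec hA s))

end TauRep

end

noncomputable section

namespace TauRep

variable {A : ℝ → ℝ}

/-! ### Basic estimates on `L²(ℝ₊)` -/

/-! Write $a_r(x)=A(x+r)$ and $R_s=(I-K_s)^{-1}$. The Hankel operator satisfies $(A_sf)(r)=\langle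
a_{r+s},f\rangle$, and $K_s=A_s^2=\int_s^\infty a_r\otimes a_r\,dr$ as a norm-convergent integral of
rank-one operators (`kOp_eq_integral`). Hence $K_s$ is compact and $\partial_sK_s=-a_s\otimes a_s$.

Invertibility. Orthogonality gives Bessel's inequality $\int_{\mathbb R}\langle
a_r,f\rangle^2dr\le\|f\|^2$. If $K_sf=f$, the part $r>s$ already exhausts the bound, so $\langle
a_r,f\rangle=0$ for $r\le s$. This vanishing makes right translates by $t\in[0,1]$ of such an $f$
fixed vectors of $K_{s-1}$ (`kOp_hankelVec`). Translates of a nonzero function on a half-line are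
independent, so the eigenspace of a compact operator would be infinite-dimensional. Thus $f=0$, and
the Fredholm alternative applies.

First derivative. Hadamard's inequality makes all series converge. Differentiating
$\det[K_s(y_i,y_j)]$ row by row replaces one row by a multiple of $a_s$. The series $E$ of the
resulting bordered integrals solves $(I-K_s)E=\mathrm{Det}(I-K_s)\,a_s$, by expansion along a
border, so $\partial_s\mathrm{Det}=\langle a_s,E\rangle=\mathrm{Det}\cdot u_0$.

Second derivative. With $k_s=K_s(\cdot,0)=A_sa_s$ one has $u_0=\|a_s\|^2+\langle k_s,R_sk_s\rangle$,
whose derivative is minus the square of $A(s)+\langle a_s,R_sk_s\rangle$.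

Finally $\mathrm{Det}\cdot\exp\int_s^\infty u_0$ is constant and tends to $1$ at $+\infty$. This
gives the exponential formula and, with it, positivity. -/

theorem Admissible.exists_uniform_bound (hA : Admissible A) (S : ℝ) :
    ∃ C c : ℝ, 0 < C ∧ 0 < c ∧ ∀ s, S ≤ s → ∀ x, 0 ≤ x →
      |A (x + s)| ≤ C * Real.exp (-c * (s - S)) * Real.exp (-c * x) := by
  obtain ⟨C, c, hC, hc, hb⟩ := hA.exists_bound S
  refine ⟨C, c, hC, hc, fun s hs x hx => ?_⟩
  have h := hb (x + (s - S)) (by linarith)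
  rw [show x + (s - S) + S = x + s by ring] at h
  refine h.trans (le_of_eq ?_)
  rw [mul_assoc, ← Real.exp_add]
  congr 2
  ring

theorem inner_toLp {g : ℝ → ℝ} (hg : MemLp g 2 halfLine) (f : L2) :
    inner ℝ (hg.toLp g) f = ∫ x in Ioi (0 : ℝ), g x * f x := by
  rw [L2.inner_def]
  refine integral_congr_ae ?_
  filter_upwards [hg.coeFn_toLp] with x hx
  rw [hx]
  simp [mul_comm]

theorem inner_eq_integral (f g : L2) : inner ℝ f g = ∫ x in Ioi (0 : ℝ), f x * g x := by
  rw [L2.inner_def]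
  simp [mul_comm]

theorem inner_aVec (hA : Admissible A) (s : ℝ) (f : L2) :
    inner ℝ (aVec hA s) f = ∫ x in Ioi (0 : ℝ), A (x + s) * f x := by
  rw [aVec, inner_toLp]
  simp [aKernel]

theorem norm_sq_toLp {g : ℝ → ℝ} (hg : MemLp g 2 halfLine) :
    ‖hg.toLp g‖ ^ 2 = ∫ x in Ioi (0 : ℝ), g x ^ 2 := by
  rw [← real_inner_self_eq_norm_sq, inner_toLp]
  refine integral_congr_ae ?_
  filter_upwards [hg.coeFn_toLp] with x hx
  rw [hx, sq]

theorem norm_toLp_le {g h : ℝ → ℝ} (hg : MemLp g 2 halfLine) (hh : MemLp h 2 halfLine)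
    (hgh : ∀ x, 0 < x → |g x| ≤ h x) : ‖hg.toLp g‖ ≤ ‖hh.toLp h‖ := by
  refine Lp.norm_le_norm_of_ae_le ?_
  filter_upwards [hg.coeFn_toLp, hh.coeFn_toLp, ae_restrict_mem measurableSet_Ioi] with x h1 h2 h3
  rw [h1, h2, Real.norm_eq_abs, Real.norm_eq_abs]
  exact (hgh x h3).trans (le_abs_self _)

theorem Admissible.exists_norm_aVec_le (hA : Admissible A) (S : ℝ) :
    ∃ C c : ℝ, 0 < C ∧ 0 < c ∧ ∀ s, S ≤ s → ‖aVec hA s‖ ≤ C * Real.exp (-c * (s - S)) := by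
  obtain ⟨C, c, hC, hc, hb⟩ := hA.exists_uniform_bound S
  refine ⟨C * ‖(memLp_exp hc).toLp _‖ + 1, c, by positivity, hc, fun s hs => ?_⟩
  have h1 : ‖aVec hA s‖ ≤ ‖((memLp_exp hc).const_mul (C * Real.exp (-c * (s - S)))).toLp _‖ := by
    refine norm_toLp_le _ _ fun x hx => ?_
    simpa [aKernel] using hb s hs x hx.le
  have h2 : ((memLp_exp hc).const_mul (C * Real.exp (-c * (s - S)))).toLp _ =
      (C * Real.exp (-c * (s - S))) • (memLp_exp hc).toLp _ := by
    rw [← MemLp.toLp_const_smul]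
    rfl
  rw [h2, norm_smul, Real.norm_of_nonneg (by positivity)] at h1
  nlinarith [Real.exp_pos (-c * (s - S))]

theorem continuous_aVec (hA : Admissible A) : Continuous (aVec hA) := by
  rw [continuous_iff_continuousAt]
  intro s
  -- Starting the bound at `s - 1` gives one integrable envelope for all `t` near `s`.
  obtain ⟨C, c, hC, hc, hb⟩ := hA.exists_uniform_bound (s - 1)
  have hcont := hA.smooth.continuous
  have key : Tendsto (fun t => ∫ x in Ioi (0 : ℝ), (A (x + t) - A (x + s)) ^ 2) (nhds s)
      (nhds (∫ x in Ioi (0 : ℝ), (A (x + s) - A (x + s)) ^ 2)) := by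
    refine tendsto_integral_filter_of_dominated_convergence
      (fun x => (2 * C) ^ 2 * Real.exp (-c * x) ^ 2) ?_ ?_ ?_ ?_
    · exact Eventually.of_forall fun t => by fun_prop
    · filter_upwards [Ioi_mem_nhds (show s - 1 < s by linarith)] with t ht
      filter_upwards [ae_restrict_mem measurableSet_Ioi] with x hx
      have e : ∀ t, s - 1 ≤ t → |A (x + t)| ≤ C * Real.exp (-c * x) := fun t ht => by
        refine (hb t ht x (le_of_lt hx)).trans ?_
        have : Real.exp (-c * (t - (s - 1))) ≤ 1 := Real.exp_le_one_iff.2 (by nlinarith)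
        have := Real.exp_pos (-c * x)
        gcongr
        nlinarith
      have h1 := e t (le_of_lt ht)
      have h2 := e s (by linarith)
      rw [Real.norm_eq_abs, abs_pow, ← mul_pow]
      refine pow_le_pow_left₀ (abs_nonneg _) ?_ 2
      refine (abs_sub _ _).trans (by linarith)
    · exact (memLp_exp hc).integrable_sq.const_mul _
    · refine ae_of_all _ fun x => ?_
      exact ((by fun_prop : Continuous fun t => (A (x + t) - A (x + s)) ^ 2)).tendsto s
  have e : ∀ t, ‖aVec hA t - aVec hA s‖ ^ 2 = ∫ x in Ioi (0 : ℝ), (A (x + t) - A (x + s)) ^ 2 := by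
    intro t
    rw [aVec, aVec, ← MemLp.toLp_sub, norm_sq_toLp]
    simp [aKernel]
  rw [ContinuousAt, tendsto_iff_norm_sub_tendsto_zero]
  have h3 : Tendsto (fun t => ‖aVec hA t - aVec hA s‖ ^ 2) (nhds s) (nhds 0) := by
    simp_rw [e]
    simpa using key
  have h4 := h3.sqrt
  simpa [Real.sqrt_sq] using h4

/-! ### The operators `A_s` and `K_s` -/

theorem integral_Ioi_comp_add_right {E : Type*} [NormedAddCommGroup E] [NormedSpace ℝ E]
    (F : ℝ → E) (a s : ℝ) : ∫ r in Ioi a, F (r + s) = ∫ r in Ioi (a + s), F r := by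
  have h := (measurePreserving_add_right volume s).setIntegral_preimage_emb
    (measurableEmbedding_addRight s) F (Ioi (a + s))
  rw [← h]
  congr 2
  ext x
  simp

/-- Source of the derivatives of `kOp`, `kVec`, $\|a_s\|^2$ and the kernel: a shift of variable
moves the dependence on `s` into the lower limit alone, so $A'$ never appears. -/
theorem hasDerivAt_integral_Ioi {E : Type*} [NormedAddCommGroup E] [NormedSpace ℝ E]
    [CompleteSpace E] {F : ℝ → E} (hF : Continuous F) (hi : ∀ s, IntegrableOn F (Ioi s)) (s : ℝ) :
    HasDerivAt (fun t => ∫ r in Ioi t, F r) (-F s) s := by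
  have h1 : HasDerivAt (fun t => (∫ r in Ioi s, F r) - ∫ r in s..t, F r) (-F s) s := by
    simpa using (intervalIntegral.integral_hasDerivAt_right (hF.intervalIntegrable s s)
      (hF.stronglyMeasurableAtFilter _ _) hF.continuousAt).const_sub (∫ r in Ioi s, F r)
  refine h1.congr_of_eventuallyEq (Eventually.of_forall fun t => ?_)
  have := intervalIntegral.integral_interval_add_Ioi (μ := volume) (hi s) (hi t)
  simp only [← this]
  abel

section Kernel

variable {k : ℝ → ℝ → ℝ}

theorem integrable_kernel_mul_mul (hk : MemLp (Function.uncurry k) 2 (halfLine.prod halfLine))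
    {f g : ℝ → ℝ} (hf : MemLp f 2 halfLine) (hg : MemLp g 2 halfLine) :
    Integrable (fun p : ℝ × ℝ => k p.1 p.2 * (f p.1 * g p.2)) (halfLine.prod halfLine) := by
  refine MemLp.integrable_mul (p := 2) (q := 2) hk ?_
  refine (memLp_two_iff_integrable_sq (hf.1.comp_fst.mul hg.1.comp_snd)).2 ?_
  simpa only [Pi.mul_apply, mul_pow] using hf.integrable_sq.mul_prod hg.integrable_sq

theorem inner_kernelOperator (hk : MemLp (Function.uncurry k) 2 (halfLine.prod halfLine))
    (f g : L2) :
    inner ℝ f (kernelOperator k hk g) =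
      ∫ p, k p.1 p.2 * (f p.1 * g p.2) ∂(halfLine.prod halfLine) := by
  rw [integral_prod _ (integrable_kernel_mul_mul hk (Lp.memLp f) (Lp.memLp g)), inner_eq_integral]
  refine integral_congr_ae ?_
  filter_upwards [kernelOperator_apply_ae hk g] with x hx
  rw [hx, ← integral_const_mul]
  congr 1
  funext y
  ring

theorem inner_kernelOperator_comm (hk : MemLp (Function.uncurry k) 2 (halfLine.prod halfLine))
    (hsymm : ∀ x y, k x y = k y x) (f g : L2) :
    inner ℝ (kernelOperator k hk f) g = inner ℝ f (kernelOperator k hk g) := by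
  rw [real_inner_comm, inner_kernelOperator, inner_kernelOperator, ← integral_prod_swap]
  congr 1
  funext p
  simp only [Prod.fst_swap, Prod.snd_swap, hsymm p.2 p.1]
  ring

end Kernel

theorem memLp_aKernel (hA : Admissible A) (s : ℝ) :
    MemLp (Function.uncurry (aKernel A s)) 2 (halfLine.prod halfLine) := by
  obtain ⟨C, c, hC, hc, hb⟩ := hA.exists_bound s
  have hprod : MemLp (fun p : ℝ × ℝ => Real.exp (-c * p.1) * Real.exp (-c * p.2)) 2
      (halfLine.prod halfLine) := by
    refine (memLp_two_iff_integrable_sq (by fun_prop)).2 ?_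
    have h := (memLp_exp hc).integrable_sq
    simpa only [mul_pow] using h.mul_prod h
  refine (hprod.const_mul C).mono' (continuous_aKernel hA s).aestronglyMeasurable ?_
  rw [Measure.prod_restrict]
  filter_upwards [ae_restrict_mem (measurableSet_Ioi.prod measurableSet_Ioi)] with p hp
  have h1 : 0 < p.1 := hp.1
  have h2 : 0 < p.2 := hp.2
  have := hb (p.1 + p.2) (by linarith)
  rwa [mul_add, Real.exp_add] at this

/-- The Hankel operator `A_s` on `L²(ℝ₊)`. -/
def aOp (hA : Admissible A) (s : ℝ) : L2 →L[ℝ] L2 :=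
  kernelOperator (aKernel A s) (memLp_aKernel hA s)

theorem aOp_apply_ae (hA : Admissible A) (s : ℝ) (f : L2) :
    aOp hA s f =ᵐ[halfLine] fun r => inner ℝ (aVec hA (r + s)) f := by
  filter_upwards [kernelOperator_apply_ae (memLp_aKernel hA s) f] with r hr
  rw [aOp, hr, inner_aVec]
  congr 1
  funext y
  rw [aKernel, show r + y + s = y + (r + s) by ring]

theorem inner_aOp_comm (hA : Admissible A) (s : ℝ) (f g : L2) :
    inner ℝ (aOp hA s f) g = inner ℝ f (aOp hA s g) :=
  inner_kernelOperator_comm _ (fun x y => by rw [aKernel, aKernel, add_comm x y]) f g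

/-- This identity lets $u_0$ be rewritten through $K_s(\cdot,0)$, and so links it to $q_0$. -/
theorem aOp_aVec (hA : Admissible A) (s : ℝ) : aOp hA s (aVec hA s) = kVec hA s := by
  refine Lp.ext ?_
  filter_upwards [aOp_apply_ae hA s (aVec hA s), (memLp_kKernel_zero hA s).coeFn_toLp] with x h1 h2
  rw [h1, kVec, h2, real_inner_comm, inner_aVec, kKernel]
  refine integral_congr_ae ?_
  filter_upwards [(memLp_aKernel_zero hA (x + s)).coeFn_toLp] with y hy
  rw [aVec, hy]
  simp only [aKernel]
  rw [mul_comm]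
  congr 2 <;> ring

theorem aOp_mul_aOp (hA : Admissible A) (s : ℝ) (f : L2) :
    aOp hA s (aOp hA s f) = kOp hA s f := by
  refine Lp.ext ?_
  filter_upwards [kernelOperator_apply_ae (memLp_aKernel hA s) (aOp hA s f),
    kernelOperator_apply_ae (memLp_kKernel hA s) f, ae_restrict_mem measurableSet_Ioi]
    with x h1 h2 hx
  rw [kOp, h2]
  refine h1.trans ?_
  -- The row $r\mapsto A_s(x,r)$ is $a_{x+s}$, hence square integrable; this is what justifies
  -- Fubini below.
  have hax : MemLp (fun r => aKernel A s x r) 2 halfLine := by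
    have := memLp_aKernel_zero hA (x + s)
    refine this.congr_norm ?_ (ae_of_all _ fun r => ?_)
    · exact ((continuous_aKernel hA s).comp (by fun_prop :
        Continuous fun r : ℝ => (x, r))).aestronglyMeasurable
    · simp only [aKernel]
      congr 2
      ring
  have hint := integrable_kernel_mul_mul (memLp_aKernel hA s) hax (Lp.memLp f)
  have e1 : ∫ r in Ioi (0 : ℝ), aKernel A s x r * aOp hA s f r =
      ∫ r in Ioi (0 : ℝ), ∫ y in Ioi (0 : ℝ), aKernel A s r y * (aKernel A s x r * f y) := by
    refine integral_congr_ae ?_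
    filter_upwards [kernelOperator_apply_ae (memLp_aKernel hA s) f] with r hr
    rw [aOp, hr, ← integral_const_mul]
    congr 1
    funext y
    ring
  have e2 := integral_integral_swap
    (f := fun r y => aKernel A s r y * (aKernel A s x r * f y)) hint
  refine e1.trans (e2.trans ?_)
  congr 1
  funext y
  rw [kKernel, ← integral_mul_const]
  congr 1
  funext r
  rw [show aKernel A s y r = aKernel A s r y by rw [aKernel, aKernel, add_comm y r]]
  ring

/-- The shift $r\mapsto r+s$ leaves an integrand independent of `s`. -/
theorem inner_aOp_aOp (hA : Admissible A) (s : ℝ) (f g : L2) :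
    inner ℝ (aOp hA s f) (aOp hA s g) =
      ∫ r in Ioi s, inner ℝ (aVec hA r) f * inner ℝ (aVec hA r) g := by
  have h := integral_Ioi_comp_add_right
    (fun r => inner ℝ (aVec hA r) f * inner ℝ (aVec hA r) g) 0 s
  rw [zero_add] at h
  rw [← h, inner_eq_integral]
  refine integral_congr_ae ?_
  filter_upwards [aOp_apply_ae hA s f, aOp_apply_ae hA s g] with r h1 h2
  rw [h1, h2]

theorem inner_kOp (hA : Admissible A) (s : ℝ) (f g : L2) :
    inner ℝ f (kOp hA s g) = ∫ r in Ioi s, inner ℝ (aVec hA r) f * inner ℝ (aVec hA r) g := by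
  rw [← aOp_mul_aOp, ← inner_aOp_comm, inner_aOp_aOp]

/-- The rank-one operator `f ↦ ⟨a_r, f⟩ a_r`. -/
def aRankOne (hA : Admissible A) (r : ℝ) : L2 →L[ℝ] L2 :=
  InnerProductSpace.rankOne ℝ (aVec hA r) (aVec hA r)

theorem aRankOne_apply (hA : Admissible A) (r : ℝ) (f : L2) :
    aRankOne hA r f = inner ℝ (aVec hA r) f • aVec hA r := rfl

theorem continuous_aRankOne (hA : Admissible A) : Continuous (aRankOne hA) := by
  have h := continuous_aVec hA
  unfold aRankOne
  exact ((InnerProductSpace.rankOne (E := L2) (F := L2) ℝ).continuous.comp h).clm_apply h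

theorem exp_decay_integrableOn {E : Type*} [NormedAddCommGroup E] {F : ℝ → E} (hF : Continuous F)
    {s C c : ℝ} (hc : 0 < c) (hb : ∀ r, s ≤ r → ‖F r‖ ≤ C * Real.exp (-c * (r - s))) :
    IntegrableOn F (Ioi s) := by
  have h : IntegrableOn (fun r => C * Real.exp (c * s) * Real.exp (-c * r)) (Ioi s) :=
    (exp_neg_integrableOn_Ioi s hc).const_mul _
  refine Integrable.mono' h hF.aestronglyMeasurable ?_
  filter_upwards [ae_restrict_mem measurableSet_Ioi] with r hr
  refine (hb r (le_of_lt hr)).trans (le_of_eq ?_)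
  rw [mul_assoc, ← Real.exp_add]
  congr 2
  ring

theorem integrableOn_aRankOne (hA : Admissible A) (s : ℝ) :
    IntegrableOn (aRankOne hA) (Ioi s) := by
  obtain ⟨C, c, hC, hc, hb⟩ := hA.exists_norm_aVec_le s
  refine exp_decay_integrableOn (continuous_aRankOne hA) (C := C * C) (c := c + c)
    (by positivity) fun r hr => ?_
  rw [aRankOne, InnerProductSpace.norm_rankOne]
  have := mul_le_mul (hb r hr) (hb r hr) (norm_nonneg _) (by positivity)
  refine this.trans (le_of_eq ?_)
  rw [mul_mul_mul_comm, ← Real.exp_add]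
  congr 2
  ring

/-- The weak identity `inner_kOp` becomes an equality of Bochner integrals because $\|a_r\otimes
a_r\|=\|a_r\|^2$ decays exponentially. Norm convergence is what yields both compactness and the
operator derivative. -/
theorem kOp_eq_integral (hA : Admissible A) (s : ℝ) :
    kOp hA s = ∫ r in Ioi s, aRankOne hA r := by
  ext1 g
  refine ext_inner_left ℝ fun f => ?_
  have h1 := integrableOn_aRankOne hA s
  rw [ContinuousLinearMap.integral_apply h1, inner_kOp,
    ← integral_inner (h1.apply_continuousLinearMap g)]
  congr 1
  funext r
  rw [aRankOne_apply, inner_smul_right, real_inner_comm f]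
  ring

theorem hasDerivAt_kOp (hA : Admissible A) (s : ℝ) :
    HasDerivAt (kOp hA) (-aRankOne hA s) s := by
  have h := hasDerivAt_integral_Ioi (continuous_aRankOne hA) (integrableOn_aRankOne hA) s
  rwa [← funext (kOp_eq_integral hA)] at h

theorem Admissible.exists_abs_le (hA : Admissible A) (S : ℝ) :
    ∃ C c : ℝ, 0 < C ∧ 0 < c ∧ ∀ s, S ≤ s → |A s| ≤ C * Real.exp (-c * (s - S)) := by
  obtain ⟨C, c, hC, hc, hb⟩ := hA.exists_uniform_bound S
  exact ⟨C, c, hC, hc, fun s hs => by simpa using hb s hs 0 le_rfl⟩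

theorem integrableOn_smul_aVec (hA : Admissible A) (s : ℝ) :
    IntegrableOn (fun r => A r • aVec hA r) (Ioi s) := by
  obtain ⟨C, c, hC, hc, hb⟩ := hA.exists_norm_aVec_le s
  obtain ⟨C', c', hC', hc', hb'⟩ := hA.exists_abs_le s
  refine exp_decay_integrableOn (hA.smooth.continuous.fun_smul (continuous_aVec hA)) (C := C' * C)
    (c := c' + c) (by positivity) fun r hr => ?_
  rw [norm_smul, Real.norm_eq_abs]
  refine (mul_le_mul (hb' r hr) (hb r hr) (norm_nonneg _) (by positivity)).trans (le_of_eq ?_)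
  rw [mul_mul_mul_comm, ← Real.exp_add]
  congr 2
  ring

theorem kVec_eq_integral (hA : Admissible A) (s : ℝ) :
    kVec hA s = ∫ r in Ioi s, A r • aVec hA r := by
  refine ext_inner_left ℝ fun f => ?_
  rw [← integral_inner (integrableOn_smul_aVec hA s), ← aOp_aVec, ← inner_aOp_comm, real_inner_comm,
    inner_aVec]
  have h := integral_Ioi_comp_add_right (fun r => inner ℝ f (A r • aVec hA r)) 0 s
  rw [zero_add] at h
  rw [← h]
  refine integral_congr_ae ?_
  filter_upwards [aOp_apply_ae hA s f] with r hr
  rw [hr, inner_smul_right, real_inner_comm f]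

theorem hasDerivAt_kVec (hA : Admissible A) (s : ℝ) :
    HasDerivAt (kVec hA) (-(A s • aVec hA s)) s := by
  have h := hasDerivAt_integral_Ioi (hA.smooth.continuous.fun_smul (continuous_aVec hA))
    (integrableOn_smul_aVec hA) s
  rwa [← funext (kVec_eq_integral hA)] at h

/-- Indeed $\|a_t\|^2=\int_t^\infty A^2$. -/
theorem hasDerivAt_norm_aVec_sq (hA : Admissible A) (s : ℝ) :
    HasDerivAt (fun t => ‖aVec hA t‖ ^ 2) (-(A s) ^ 2) s := by
  have hi : ∀ s, IntegrableOn (fun r => A r ^ 2) (Ioi s) := fun s => by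
    obtain ⟨C, c, hC, hc, hb⟩ := hA.exists_abs_le s
    refine exp_decay_integrableOn (hA.smooth.continuous.fun_pow 2) (C := C * C) (c := c + c)
      (by positivity) fun r hr => ?_
    rw [norm_pow, Real.norm_eq_abs, sq]
    refine (mul_le_mul (hb r hr) (hb r hr) (abs_nonneg _) (by positivity)).trans (le_of_eq ?_)
    rw [mul_mul_mul_comm, ← Real.exp_add]
    congr 2
    ring
  have h := hasDerivAt_integral_Ioi (hA.smooth.continuous.fun_pow 2) hi s
  refine h.congr_of_eventuallyEq (Eventually.of_forall fun t => ?_)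
  have h2 := integral_Ioi_comp_add_right (fun r => A r ^ 2) 0 t
  rw [zero_add] at h2
  simp only [aVec, norm_sq_toLp, aKernel, add_zero]
  exact h2

/-- The quotient map by the closed subspace commutes with the integral and kills the integrand. -/
theorem integral_mem_of_isClosed {E α : Type*} [NormedAddCommGroup E] [NormedSpace ℝ E]
    [CompleteSpace E] [MeasurableSpace α] {μ : Measure α} {M : Submodule ℝ E}
    (hM : IsClosed (M : Set E)) {f : α → E} (hf : Integrable f μ) (hfM : ∀ x, f x ∈ M) :
    ∫ x, f x ∂μ ∈ M := by
  have := hM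
  have h := ContinuousLinearMap.integral_comp_comm (𝕜 := ℝ) (M.mkQL) hf
  rw [← Submodule.Quotient.mk_eq_zero, ← Submodule.mkQ_apply, ← Submodule.mkQL_apply, ← h]
  refine integral_eq_zero_of_ae (ae_of_all _ fun x => ?_)
  simpa using hfM x

theorem isCompactOperator_aRankOne (hA : Admissible A) (r : ℝ) :
    IsCompactOperator (aRankOne hA r) := by
  have : IsCompactOperator (innerSL ℝ (aVec hA r)) :=
    (isCompactOperator_id (E := ℝ)).comp_clm (innerSL ℝ (aVec hA r))
  exact this.clm_comp (ContinuousLinearMap.toSpanSingleton ℝ (aVec hA r))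

theorem isCompactOperator_kOp (hA : Admissible A) (s : ℝ) : IsCompactOperator (kOp hA s) := by
  rw [kOp_eq_integral]
  exact integral_mem_of_isClosed (M := compactOperator (RingHom.id ℝ) L2 L2)
    isClosed_setOfPred_isCompactOperator (integrableOn_aRankOne hA s)
    (isCompactOperator_aRankOne hA)

/-! ### Invertibility of `1 - K_s` -/

theorem inner_toLp_toLp {α : Type*} [MeasurableSpace α] {μ : Measure α} {g h : α → ℝ}
    (hg : MemLp g 2 μ) (hh : MemLp h 2 μ) :
    inner ℝ (hg.toLp g) (hh.toLp h) = ∫ x, g x * h x ∂μ := by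
  rw [L2.inner_def]
  refine integral_congr_ae ?_
  filter_upwards [hg.coeFn_toLp, hh.coeFn_toLp] with x h1 h2
  rw [h1, h2]
  simp [mul_comm]

/-- Square-integrable functions on the half-line are limits of test functions supported in
`[-1, ∞)`. -/
theorem exists_seq_test_function (f : L2) :
    ∃ ψ : ℕ → ℝ → ℝ, (∀ n, ContDiff ℝ ∞ (ψ n)) ∧ (∀ n, HasCompactSupport (ψ n)) ∧
      (∀ n x, x ≤ -1 → ψ n x = 0) ∧
      Tendsto (fun n => eLpNorm ((Ioi (0 : ℝ)).indicator f - ψ n) 2 volume) atTop (nhds 0) := by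
  have hF : MemLp ((Ioi (0 : ℝ)).indicator f) 2 volume :=
    (memLp_indicator_iff_restrict measurableSet_Ioi).2 (Lp.memLp f)
  have hex : ∀ n : ℕ, ∃ g : ℝ → ℝ, HasCompactSupport g ∧ ContDiff ℝ ∞ g ∧
      eLpNorm ((Ioi (0 : ℝ)).indicator f - g) 2 volume ≤ ENNReal.ofReal (1 / ((n : ℝ) + 1)) :=
    fun n => hF.exist_eLpNorm_sub_le (by norm_num) (by norm_num) (by positivity)
  choose φ h1 h2 h3 using hex
  -- The cutoff is $0$ on $(-\infty,-1]$ and $1$ on $[0,\infty)$. Multiplying by it does not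
  -- increase the distance to a function carried by $(0,\infty)$.
  let χ : ℝ → ℝ := fun x => Real.smoothTransition (x + 1)
  have hχ : ContDiff ℝ ∞ χ := Real.smoothTransition.contDiff.comp (by fun_prop)
  refine ⟨fun n x => χ x * φ n x, fun n => hχ.mul (h2 n), fun n => (h1 n).mul_left,
    fun n x hx => ?_, ?_⟩
  · simp only [χ]
    rw [Real.smoothTransition.zero_of_nonpos (by linarith), zero_mul]
  · have hlim : Tendsto (fun n : ℕ => ENNReal.ofReal (1 / ((n : ℝ) + 1))) atTop (nhds 0) := by
      simpa using ENNReal.tendsto_ofReal (tendsto_one_div_add_atTop_nhds_zero_nat (𝕜 := ℝ))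
    refine tendsto_of_tendsto_of_tendsto_of_le_of_le tendsto_const_nhds hlim
      (fun _ => zero_le) fun n => ?_
    refine (eLpNorm_mono fun x => ?_).trans (h3 n)
    have e : ((Ioi (0 : ℝ)).indicator f - fun x => χ x * φ n x) x =
        χ x * ((Ioi (0 : ℝ)).indicator f - φ n) x := by
      simp only [Pi.sub_apply, mul_sub, sub_left_inj]
      by_cases hx : 0 < x
      · simp only [χ]
        rw [Real.smoothTransition.one_of_one_le (by linarith), one_mul]
      · simp [indicator, hx]
    rw [e, norm_mul]
    refine mul_le_of_le_one_left (norm_nonneg _) ?_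
    rw [Real.norm_of_nonneg (Real.smoothTransition.nonneg _)]
    exact Real.smoothTransition.le_one _

/-- Bessel's inequality for the family `a_r`, `r ∈ ℝ`. -/
theorem lintegral_inner_aVec_sq_le (hA : Admissible A) (f : L2) :
    ∫⁻ r, ENNReal.ofReal (inner ℝ (aVec hA r) f ^ 2) ≤ ENNReal.ofReal (‖f‖ ^ 2) := by
  have hF : MemLp ((Ioi (0 : ℝ)).indicator f) 2 volume :=
    (memLp_indicator_iff_restrict measurableSet_Ioi).2 (Lp.memLp f)
  obtain ⟨ψ, hsm, hcs, hz, hlim⟩ := exists_seq_test_function f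
  have hψ : ∀ n, MemLp (ψ n) 2 volume := fun n =>
    (hsm n).continuous.memLp_of_hasCompactSupport (hcs n)
  have hconv : Tendsto (fun n => (hψ n).toLp (ψ n)) atTop (nhds (hF.toLp _)) := by
    rw [Lp.tendsto_Lp_iff_tendsto_eLpNorm'' _ hψ _ hF]
    simpa only [eLpNorm_sub_comm] using hlim
  have hnormF : ‖hF.toLp _‖ ^ 2 = ‖f‖ ^ 2 := by
    rw [← real_inner_self_eq_norm_sq, ← real_inner_self_eq_norm_sq, inner_toLp_toLp,
      inner_eq_integral, ← integral_indicator measurableSet_Ioi]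
    congr 1
    funext x
    by_cases hx : x ∈ Ioi (0 : ℝ) <;> simp [hx]
  have hpt : ∀ r, Tendsto (fun n => ∫ x, A (r + x) * ψ n x) atTop
      (nhds (inner ℝ (aVec hA r) f)) := by
    intro r
    -- Nothing is assumed about `A` at $-\infty$. Since every `ψ n` vanishes left of $-1$, only the
    -- square-integrable restriction to $(-1,\infty)$ enters.
    have hB : MemLp ((Ioi (-1 : ℝ)).indicator fun x => A (r + x)) 2 volume := by
      rw [memLp_indicator_iff_restrict measurableSet_Ioi]
      obtain ⟨C, c, hC, hc, hb⟩ := hA.exists_bound (r - 1)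
      refine (memLp_two_iff_integrable_sq ?_).2 ?_
      · have := hA.smooth.continuous
        fun_prop
      · refine exp_decay_integrableOn (C := C ^ 2) (c := c + c) ?_ (by positivity) fun x hx => ?_
        · have := hA.smooth.continuous
          fun_prop
        · have := hb (x + 1) (by linarith)
          rw [show x + 1 + (r - 1) = r + x by ring] at this
          rw [norm_pow, Real.norm_eq_abs]
          refine (pow_le_pow_left₀ (abs_nonneg _) this 2).trans (le_of_eq ?_)
          rw [mul_pow, sq (Real.exp _), ← Real.exp_add]
          congr 2
          ring
    have h1 : Tendsto (fun n => inner ℝ (hB.toLp _) ((hψ n).toLp (ψ n))) atTop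
        (nhds (inner ℝ (hB.toLp _) (hF.toLp _))) :=
      tendsto_const_nhds.inner hconv
    have e1 : ∀ n, inner ℝ (hB.toLp _) ((hψ n).toLp (ψ n)) = ∫ x, A (r + x) * ψ n x := by
      intro n
      rw [inner_toLp_toLp]
      congr 1
      funext x
      by_cases hx : -1 < x
      · simp [indicator, hx]
      · simp [hz n x (by linarith)]
    have e2 : inner ℝ (hB.toLp _) (hF.toLp _) = inner ℝ (aVec hA r) f := by
      rw [inner_toLp_toLp, inner_aVec, ← integral_indicator measurableSet_Ioi]
      congr 1
      funext x
      by_cases hx : 0 < x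
      · have : -1 < x := by linarith
        simp [indicator, hx, this, add_comm]
      · simp [indicator, hx]
    rw [e2] at h1
    simpa only [e1] using h1
  have hint : ∀ n, ∫⁻ r, ENNReal.ofReal ((∫ x, A (r + x) * ψ n x) ^ 2) =
      ENNReal.ofReal (‖(hψ n).toLp (ψ n)‖ ^ 2) := by
    intro n
    obtain ⟨h1, h2⟩ := hA.orthogonal (ψ n) (ψ n) (hsm n) (hcs n) (hsm n) (hcs n)
    simp only [← sq] at h1
    rw [← ofReal_integral_eq_lintegral_ofReal h1 (ae_of_all _ fun r => sq_nonneg _),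
      ← real_inner_self_eq_norm_sq, inner_toLp_toLp, ← h2]
    simp only [sq]
  have hmeas : ∀ n, AEMeasurable (fun r => ENNReal.ofReal ((∫ x, A (r + x) * ψ n x) ^ 2)) := by
    intro n
    obtain ⟨h1, h2⟩ := hA.orthogonal (ψ n) (ψ n) (hsm n) (hcs n) (hsm n) (hcs n)
    simp only [← sq] at h1
    exact h1.1.aemeasurable.ennreal_ofReal
  -- Orthogonality is exact for test functions; Fatou's lemma keeps one inequality in the limit,
  -- which suffices.
  calc ∫⁻ r, ENNReal.ofReal (inner ℝ (aVec hA r) f ^ 2)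
      = ∫⁻ r, liminf (fun n => ENNReal.ofReal ((∫ x, A (r + x) * ψ n x) ^ 2)) atTop := by
        congr 1
        funext r
        exact (ENNReal.tendsto_ofReal ((hpt r).pow 2)).liminf_eq.symm
    _ ≤ liminf (fun n => ∫⁻ r, ENNReal.ofReal ((∫ x, A (r + x) * ψ n x) ^ 2)) atTop :=
        lintegral_liminf_le' hmeas
    _ = ENNReal.ofReal (‖f‖ ^ 2) := by
        simp only [hint]
        rw [← hnormF]
        exact (ENNReal.tendsto_ofReal (hconv.norm.pow 2)).liminf_eq

theorem continuous_inner_aVec (hA : Admissible A) (f : L2) :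
    Continuous fun r => inner ℝ (aVec hA r) f :=
  (continuous_aVec hA).inner continuous_const

theorem integrableOn_inner_aVec_sq (hA : Admissible A) (s : ℝ) (f : L2) :
    IntegrableOn (fun r => inner ℝ (aVec hA r) f ^ 2) (Ioi s) := by
  have h := ((integrableOn_aRankOne hA s).apply_continuousLinearMap f).const_inner (𝕜 := ℝ) f
  refine h.congr (ae_of_all _ fun r => ?_)
  simp only [aRankOne_apply, inner_smul_right]
  rw [real_inner_comm f, sq]

/-- The integral over $(s,\infty)$ equals $\|f\|^2$, the full Bessel bound, so nothing is left on
$(-\infty,s]$. Continuity in `r` turns almost everywhere into everywhere. -/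
theorem inner_aVec_eq_zero_of_kOp_eq_self (hA : Admissible A) {s : ℝ} {f : L2}
    (hf : kOp hA s f = f) {r : ℝ} (hr : r ≤ s) : inner ℝ (aVec hA r) f = 0 := by
  have h1 : ∫ r in Ioi s, inner ℝ (aVec hA r) f ^ 2 = ‖f‖ ^ 2 := by
    have := inner_kOp hA s f f
    rw [hf, real_inner_self_eq_norm_sq] at this
    simpa only [sq] using this.symm
  have h2 : ∫⁻ r in Ioi s, ENNReal.ofReal (inner ℝ (aVec hA r) f ^ 2) =
      ENNReal.ofReal (‖f‖ ^ 2) := by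
    rw [← h1, ofReal_integral_eq_lintegral_ofReal (integrableOn_inner_aVec_sq hA s f)
      (ae_of_all _ fun r => sq_nonneg _)]
  have hmeas : Measurable fun r => ENNReal.ofReal (inner ℝ (aVec hA r) f ^ 2) :=
    ((continuous_inner_aVec hA f).pow 2).measurable.ennreal_ofReal
  have h3 := lintegral_inner_aVec_sq_le hA f
  rw [← lintegral_add_compl _ (measurableSet_Ioi (a := s)), h2, compl_Ioi] at h3
  have h4 : ∫⁻ r in Iic s, ENNReal.ofReal (inner ℝ (aVec hA r) f ^ 2) = 0 := by
    have := (ENNReal.add_le_add_iff_left ENNReal.ofReal_ne_top).1 (h3.trans_eq (add_zero _).symm)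
    exact le_antisymm this zero_le
  rw [lintegral_eq_zero_iff hmeas] at h4
  have h5 : (fun r => inner ℝ (aVec hA r) f) =ᵐ[volume.restrict (Iic s)] fun _ => 0 := by
    filter_upwards [h4] with r hr
    simpa using hr
  exact Measure.eqOn_of_ae_eq h5 (continuous_inner_aVec hA f).continuousOn continuousOn_const
    (by rw [interior_Iic, closure_Iio]) hr

theorem memLp_inner_aVec_translate (hA : Admissible A) (s : ℝ) (g : L2) :
    MemLp (fun x => inner ℝ (aVec hA (x + s)) g) 2 halfLine := by
  obtain ⟨C, c, hC, hc, hb⟩ := hA.exists_norm_aVec_le s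
  refine ((memLp_exp hc).const_mul (C * ‖g‖)).mono' ?_ ?_
  · exact ((continuous_inner_aVec hA g).comp (continuous_add_const s)).aestronglyMeasurable
  · filter_upwards [ae_restrict_mem measurableSet_Ioi] with x hx
    refine (norm_inner_le_norm _ _).trans ?_
    have := hb (x + s) (by linarith [mem_Ioi.1 hx])
    rw [add_sub_cancel_right] at this
    have h0 := norm_nonneg g
    nlinarith

/-- The function `x ↦ ⟨a_{x + s}, g⟩` as an element of `L²(ℝ₊)`. -/
def hankelVec (hA : Admissible A) (s : ℝ) (g : L2) : L2 :=
  (memLp_inner_aVec_translate hA s g).toLp _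

theorem aOp_eq_hankelVec (hA : Admissible A) (s : ℝ) (g : L2) :
    aOp hA s g = hankelVec hA s g := by
  refine Lp.ext ?_
  filter_upwards [aOp_apply_ae hA s g, (memLp_inner_aVec_translate hA s g).coeFn_toLp] with x h1 h2
  rw [h1, hankelVec, h2]

theorem inner_aVec_hankelVec (hA : Admissible A) {s t : ℝ} (ht : 0 ≤ t) {g : L2}
    (hg : ∀ r ≤ s, inner ℝ (aVec hA r) g = 0) (r : ℝ) :
    inner ℝ (aVec hA r) (hankelVec hA (s - t) g) =
      inner ℝ (aVec hA (r + t)) (hankelVec hA s g) := by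
  have e : ∀ (r s : ℝ), inner ℝ (aVec hA r) (hankelVec hA s g) =
      ∫ x in Ioi (0 : ℝ), A (x + r) * inner ℝ (aVec hA (x + s)) g := by
    intro r s
    rw [inner_aVec]
    refine integral_congr_ae ?_
    filter_upwards [(memLp_inner_aVec_translate hA s g).coeFn_toLp] with x hx
    rw [hankelVec, hx]
  rw [e, e]
  have h := integral_Ioi_comp_add_right
    (fun x => A (x + r) * inner ℝ (aVec hA (x + (s - t))) g) (-t) t
  rw [neg_add_cancel] at h
  rw [← h]
  have h2 : ∀ x, x ∉ Ioi (0 : ℝ) →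
      A (x + (r + t)) * inner ℝ (aVec hA (x + s)) g = 0 := fun x hx => by
    rw [hg (x + s) (by linarith [notMem_Ioi.1 hx]), mul_zero]
  have h3 : ∀ x : ℝ, A (x + t + r) * inner ℝ (aVec hA (x + t + (s - t))) g =
      A (x + (r + t)) * inner ℝ (aVec hA (x + s)) g := fun x => by
    rw [show x + t + r = x + (r + t) by ring, show x + t + (s - t) = x + s by ring]
  simp only [h3]
  -- After the shift the half-lines $(-t,\infty)$ and $(0,\infty)$ differ only where the integrand
  -- vanishes, so both integrals equal the one over $\mathbb R$.
  rw [setIntegral_eq_integral_of_forall_compl_eq_zero h2,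
    setIntegral_eq_integral_of_forall_compl_eq_zero]
  intro x hx
  exact h2 x fun hx' => hx (lt_of_le_of_lt (by linarith) (mem_Ioi.1 hx'))

/-- With $g=A_sf$ and $f=A_sg$, the operator $A_{s-\tau}$ sends the right translate of $f$ by $t$ to
that of $g$ by $\tau-t$, and the latter back to the former. So $K_{s-\tau}=A_{s-\tau}^2$ fixes both.
-/
theorem kOp_hankelVec (hA : Admissible A) {s t τ : ℝ} (ht : 0 ≤ t) (htτ : t ≤ τ) {f : L2}
    (hf : kOp hA s f = f) :
    kOp hA (s - τ) (hankelVec hA (s - t) (aOp hA s f)) = hankelVec hA (s - t) (aOp hA s f) := by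
  set g := aOp hA s f with hg
  have hgf : aOp hA s g = f := by rw [hg, aOp_mul_aOp, hf]
  have hgK : kOp hA s g = g := by rw [← aOp_mul_aOp, hgf]
  have key : ∀ (f g : L2) (t : ℝ), 0 ≤ t → aOp hA s g = f → kOp hA s g = g →
      aOp hA (s - τ) (hankelVec hA (s - t) g) = hankelVec hA (s - (τ - t)) f := by
    intro f g t ht hgf hgK
    rw [aOp_eq_hankelVec]
    refine MemLp.toLp_congr _ _ (ae_of_all _ fun x => ?_)
    simp only
    rw [inner_aVec_hankelVec hA ht fun r hr => inner_aVec_eq_zero_of_kOp_eq_self hA hgK hr,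
      ← aOp_eq_hankelVec, hgf, show x + (s - τ) + t = x + (s - (τ - t)) by ring]
  rw [← aOp_mul_aOp, key f g t ht hgf hgK, key g f (τ - t) (by linarith) hg.symm hf,
    sub_sub_cancel]

/-- The translates of a nonzero function supported in `[0, ∞)` are linearly independent. -/
theorem translates_independent {φ : ℝ → ℝ} (h0 : ∀ x ≤ 0, φ x = 0) (hne : ∃ x, φ x ≠ 0)
    {δ : ℝ} (hδ : 0 < δ) {N : ℕ} {w : Fin N → ℝ}
    (hw : ∀ x, 0 < x → ∑ j, w j * φ (x - j * δ) = 0) : ∀ i, w i = 0 := by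
  have hbdd : BddBelow {x | φ x ≠ 0} := ⟨0, fun x hx => by
    by_contra h
    exact hx (h0 x (by linarith))⟩
  -- The point `x₀` lies within `δ` of the infimum of the nonzero set, so every shift left by at
  -- least `δ` hits a zero.
  obtain ⟨x₀, hx₀, hlt⟩ := exists_lt_of_csInf_lt (s := {x | φ x ≠ 0}) hne
    (show sInf {x | φ x ≠ 0} < sInf {x | φ x ≠ 0} + δ by linarith)
  have hz : ∀ k : ℝ, 1 ≤ k → φ (x₀ - k * δ) = 0 := fun k hk => by
    by_contra h
    have := csInf_le hbdd h
    nlinarith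
  have hpos : 0 < x₀ := by
    by_contra h
    exact hx₀ (h0 x₀ (by linarith))
  intro i
  induction i using WellFoundedLT.induction with
  | _ i ih =>
    -- At this point the terms `j < i` vanish by induction and the terms `j > i` by the choice of
    -- `x₀`, leaving `w i * φ x₀`.
    have h := hw (x₀ + i * δ) (by positivity)
    rw [Finset.sum_eq_single i] at h
    · rw [add_sub_cancel_right] at h
      exact (mul_eq_zero.1 h).resolve_right hx₀
    · intro j _ hj
      rcases lt_or_gt_of_ne hj with hji | hji
      · rw [ih j hji, zero_mul]
      · have h1 : (i : ℝ) + 1 ≤ j := by exact_mod_cast hji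
        rw [show x₀ + i * δ - j * δ = x₀ - (j - i) * δ by ring, hz _ (by linarith), mul_zero]
    · simp

theorem eq_zero_of_kOp_eq_self (hA : Admissible A) {s : ℝ} {f : L2}
    (hf : kOp hA s f = f) : f = 0 := by
  by_contra hne
  have hcomp := isCompactOperator_kOp hA (s - 1)
  let V := Module.End.eigenspace (kOp hA (s - 1)).toLinearMap 1
  have hfin : FiniteDimensional ℝ V :=
    ContinuousLinearMap.finite_dimensional_eigenspace hcomp 1 one_ne_zero
  set g := aOp hA s f with hg
  have hgf : aOp hA s g = f := by rw [hg, aOp_mul_aOp, hf]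
  have hgK : kOp hA s g = g := by rw [← aOp_mul_aOp, hgf]
  let φ : ℝ → ℝ := fun x => inner ℝ (aVec hA (x + s)) g
  have hφc : Continuous φ := (continuous_inner_aVec hA g).comp (continuous_add_const s)
  have hφ0 : ∀ x ≤ 0, φ x = 0 := fun x hx =>
    inner_aVec_eq_zero_of_kOp_eq_self hA hgK (by linarith)
  have hφne : ∃ x, φ x ≠ 0 := by
    by_contra! h
    refine hne ?_
    rw [← hgf, Lp.eq_zero_iff_ae_eq_zero]
    filter_upwards [aOp_apply_ae hA s g] with x hx
    rw [hx]
    exact h x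
  -- One vector more than the dimension; the shifts `j / N` stay below $1$, hence admissible for
  -- $K_{s-1}$.
  let N := Module.finrank ℝ V + 1
  have hN : (0 : ℝ) < N := by positivity
  have hmem : ∀ j : Fin N, hankelVec hA (s - j * (1 / N : ℝ)) g ∈ V := fun j => by
    rw [Module.End.mem_eigenspace_iff, one_smul]
    refine kOp_hankelVec hA (by positivity) ?_ hf
    rw [mul_one_div, div_le_one hN]
    exact_mod_cast j.2.le
  have hli : LinearIndependent ℝ fun j : Fin N =>
      (⟨hankelVec hA (s - j * (1 / N : ℝ)) g, hmem j⟩ : V) := by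
    rw [Fintype.linearIndependent_iff]
    intro w hw
    refine translates_independent hφ0 hφne (δ := 1 / N) (by positivity) ?_
    have hw' : ∑ j, w j • hankelVec hA (s - j * (1 / N : ℝ)) g = 0 := by
      simpa using congrArg (Subtype.val) hw
    have hcoe : ∀ j : Fin N, ∀ᵐ x ∂halfLine,
        (w j • hankelVec hA (s - j * (1 / N : ℝ)) g) x = w j * φ (x - j * (1 / N)) := fun j => by
      filter_upwards [Lp.coeFn_smul (w j) (hankelVec hA (s - j * (1 / N : ℝ)) g),
        (memLp_inner_aVec_translate hA (s - j * (1 / N : ℝ)) g).coeFn_toLp] with x h1 h2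
      rw [h1, Pi.smul_apply, hankelVec, h2, smul_eq_mul]
      simp only [φ]
      rw [show x + (s - j * (1 / N : ℝ)) = x - j * (1 / N) + s by ring]
    have hae : (fun x => ∑ j, w j * φ (x - j * (1 / N))) =ᵐ[volume.restrict (Ioi 0)]
        fun _ => 0 := by
      have h1 := Lp.coeFn_finsetSum (Finset.univ : Finset (Fin N))
        fun j => w j • hankelVec hA (s - j * (1 / N : ℝ)) g
      rw [hw'] at h1
      filter_upwards [h1, Lp.coeFn_zero ℝ 2 halfLine, ae_all_iff.2 hcoe] with x h1 h2 h3
      rw [h2] at h1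
      simp only [Finset.sum_apply, h3, Pi.zero_apply] at h1
      exact h1.symm
    exact Measure.eqOn_open_of_ae_eq hae isOpen_Ioi (by fun_prop) continuousOn_const
  have := hli.fintype_card_le_finrank
  simp [N] at this

/-- Fredholm alternative: for a compact operator, $1$ is an eigenvalue or lies in the resolvent set.
-/
theorem isUnit_one_sub_kOp (hA : Admissible A) (s : ℝ) : IsUnit (1 - kOp hA s) := by
  rcases (isCompactOperator_kOp hA s).hasEigenvalue_or_mem_resolventSet one_ne_zero with h | h
  · obtain ⟨f, hf⟩ := h.exists_hasEigenvector
    refine absurd (eq_zero_of_kOp_eq_self hA (s := s) ?_) hf.2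
    simpa using hf.apply_eq_smul
  · simpa [spectrum.mem_resolventSet_iff] using h

/-! ### Determinant inequalities -/

/-- Expansion of a determinant along its first column, with the minors written through the block
obtained by deleting the first row and column. -/
theorem det_bordered {R : Type*} [CommRing R] {m : ℕ} (M : Matrix (Fin (m + 1)) (Fin (m + 1)) R) :
    M.det = M 0 0 * (M.submatrix Fin.succ Fin.succ).det -
      ∑ i : Fin m, M i.succ 0 *
        ((M.submatrix Fin.succ Fin.succ).updateRow i fun j => M 0 j.succ).det := by
  rw [Matrix.det_succ_column_zero, Fin.sum_univ_succ, sub_eq_add_neg, ← Finset.sum_neg_distrib]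
  congr 1
  · simp
  · refine Finset.sum_congr rfl fun i _ => ?_
    cases m with
    | zero => exact i.elim0
    | succ m =>
      -- Expanding the minor along row `0` and the updated block along row `i` puts the same entries
      -- `M 0 j.succ` in front of the same smaller minors; only signs remain to compare.
      rw [Matrix.det_succ_row_zero, Matrix.det_succ_row _ i, Finset.mul_sum, Finset.mul_sum,
        ← Finset.sum_neg_distrib]
      refine Finset.sum_congr rfl fun j _ => ?_
      have h : ((M.submatrix Fin.succ Fin.succ).updateRow i fun j => M 0 j.succ).submatrix
          i.succAbove j.succAbove =
          (M.submatrix i.succ.succAbove Fin.succ).submatrix Fin.succ j.succAbove := by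
        ext p q
        simp
      rw [h, Matrix.updateRow_self, Matrix.submatrix_apply, Fin.succ_succAbove_zero, Fin.val_succ]
      have hs : (-1 : R) ^ (i : ℕ) * (-1) ^ (i : ℕ) = 1 := by
        rw [← mul_pow]; simp
      ring

/-- Hadamard's inequality. -/
theorem abs_det_le_prod_norm {n : ℕ} (M : Matrix (Fin n) (Fin n) ℝ) :
    |M.det| ≤ ∏ j, √(∑ i, M i j ^ 2) := by
  have : Fact (Module.finrank ℝ (EuclideanSpace ℝ (Fin n)) = n) := ⟨by simp⟩
  let b := EuclideanSpace.basisFun (Fin n) ℝ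
  let o : Orientation ℝ (EuclideanSpace ℝ (Fin n)) (Fin n) := b.toBasis.orientation
  -- The columns of `M`; the volume form at `v` is bounded by the product of their norms.
  let v : Fin n → EuclideanSpace ℝ (Fin n) := fun j => WithLp.toLp 2 fun i => M i j
  have h := o.abs_volumeForm_apply_le v
  rw [o.volumeForm_robust' b] at h
  have e : b.toBasis.det v = M.det := by
    rw [Module.Basis.det_apply]
    congr 1
  rw [e] at h
  simpa [EuclideanSpace.norm_eq, v] using h

theorem abs_det_le_of_entry_le {n : ℕ} {M : Matrix (Fin n) (Fin n) ℝ} {C : ℝ} (hC : 0 ≤ C)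
    {w : Fin n → ℝ} (hw : ∀ j, 0 ≤ w j) (hM : ∀ i j, |M i j| ≤ C * w j) :
    |M.det| ≤ (C * √n) ^ n * ∏ j, w j := by
  refine (abs_det_le_prod_norm M).trans ?_
  have h : ∀ j, √(∑ i, M i j ^ 2) ≤ C * √n * w j := fun j => by
    have h1 : ∑ i, M i j ^ 2 ≤ ∑ _i : Fin n, (C * w j) ^ 2 :=
      Finset.sum_le_sum fun i _ => sq_le_sq.2 ((hM i j).trans (le_abs_self _))
    rw [Finset.sum_const, Finset.card_univ, Fintype.card_fin, nsmul_eq_mul] at h1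
    refine (Real.sqrt_le_sqrt h1).trans (le_of_eq ?_)
    rw [Real.sqrt_mul (by positivity), Real.sqrt_sq (mul_nonneg hC (hw j))]
    ring
  refine (Finset.prod_le_prod (fun _ _ => Real.sqrt_nonneg _) fun j _ => h j).trans (le_of_eq ?_)
  rw [Finset.prod_mul_distrib, Finset.prod_const, Finset.card_univ, Fintype.card_fin]

/-- If $p$ is the term, $n^n/n!\le e^n$ gives $p^2\le(x^2e)^n/n!$, and $2|p|\le4^{-n}+4^np^2$
removes the square at the cost of a geometric series. -/
theorem summable_hadamard (x : ℝ) :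
    Summable fun n : ℕ => (x * √n) ^ n / (n.factorial : ℝ) := by
  have h1 : Summable fun n : ℕ => ((1 / 4 : ℝ) ^ n + (4 * x ^ 2 * Real.exp 1) ^ n / n.factorial) :=
    (summable_geometric_of_lt_one (by norm_num) (by norm_num)).add
      (Real.summable_pow_div_factorial _)
  refine Summable.of_norm_bounded h1 fun n => ?_
  set p := (x * √n) ^ n / (n.factorial : ℝ) with hp
  have hf : (0 : ℝ) < n.factorial := by positivity
  have h2 : p ^ 2 ≤ (x ^ 2 * Real.exp 1) ^ n / n.factorial := by
    have h3 := Real.pow_div_factorial_le_exp (n : ℝ) (by positivity) n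
    have h4 : p ^ 2 = (x ^ 2) ^ n / n.factorial * ((n : ℝ) ^ n / n.factorial) := by
      rw [hp, div_pow, ← pow_mul, mul_comm n 2, pow_mul, mul_pow, Real.sq_sqrt (by positivity),
        mul_pow]
      field_simp
    rw [h4, mul_pow, ← Real.exp_nat_mul, mul_one, mul_div_right_comm]
    gcongr
  have h5 : (1 / 4 : ℝ) ^ n * 4 ^ n = 1 := by rw [← mul_pow]; norm_num
  have h6 : (4 * x ^ 2 * Real.exp 1) ^ n / n.factorial =
      4 ^ n * ((x ^ 2 * Real.exp 1) ^ n / n.factorial) := by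
    rw [mul_assoc 4, mul_pow]; ring
  rw [h6, Real.norm_eq_abs]
  have h7 : (0 : ℝ) < 4 ^ n := by positivity
  have h8 : 0 < (1 / 4 : ℝ) ^ n := by positivity
  have h9 : 4 ^ n * |p| ^ 2 ≤ 4 ^ n * ((x ^ 2 * Real.exp 1) ^ n / n.factorial) := by
    rw [sq_abs]; gcongr
  refine le_trans ?_ (add_le_add_right h9 _)
  have h10 : 0 ≤ 4 ^ n * (|p| - (1 / 4 : ℝ) ^ n) ^ 2 := by positivity
  have h11 : 4 ^ n * (|p| - (1 / 4 : ℝ) ^ n) ^ 2 =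
    4 ^ n * |p| ^ 2 - 2 * |p| + (1 / 4 : ℝ) ^ n := by
    linear_combination (-2 * |p| + (1 / 4 : ℝ) ^ n) * h5
  have := abs_nonneg p
  linarith

theorem summable_mul_hadamard {x : ℝ} (hx : 0 ≤ x) :
    Summable fun n : ℕ => (n : ℝ) * (x * √n) ^ n / (n.factorial : ℝ) := by
  refine Summable.of_nonneg_of_le (fun n => by positivity) (fun n => ?_) (summable_hadamard (2 * x))
  rw [mul_assoc 2, mul_pow 2]
  gcongr
  exact_mod_cast Nat.lt_two_pow_self.le

/-! ### Fredholm coefficients -/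

/-- Lebesgue measure on `ℝ₊ⁿ`. -/
abbrev halfLinePi (n : ℕ) : Measure (Fin n → ℝ) := Measure.pi fun _ => halfLine

theorem restrict_pi_Ioi (n : ℕ) :
    volume.restrict (Set.univ.pi fun _ : Fin n => Ioi (0 : ℝ)) = halfLinePi n :=
  Measure.restrict_pi_pi _ _

theorem ae_halfLinePi_pos (n : ℕ) : ∀ᵐ y ∂halfLinePi n, ∀ i, 0 < y i := by
  rw [← restrict_pi_Ioi]
  filter_upwards [ae_restrict_mem (MeasurableSet.univ_pi fun _ => measurableSet_Ioi)] with y hy i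
  exact hy i (mem_univ i)

/-- The matrix `[k(yᵢ, yⱼ)]`. -/
def kMatrix (k : ℝ → ℝ → ℝ) {n : ℕ} (y : Fin n → ℝ) : Matrix (Fin n) (Fin n) ℝ :=
  Matrix.of fun i j => k (y i) (y j)

/-- The determinant of `[k(yᵢ, yⱼ)]` with the `i`-th row replaced by `a(yⱼ)`. -/
def rowDet (k : ℝ → ℝ → ℝ) (a : ℝ → ℝ) {n : ℕ} (y : Fin n → ℝ) (i : Fin n) : ℝ :=
  ((kMatrix k y).updateRow i fun j => a (y j)).det

/-- `∫ det` of the matrix at the points `x, y₁, …, yₘ` whose first row is replaced by `a`,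
integrated over `y`. -/
def borderedCoeff (k : ℝ → ℝ → ℝ) (a : ℝ → ℝ) (m : ℕ) (x : ℝ) : ℝ :=
  ∫ y, rowDet k a (Fin.cons x y : Fin (m + 1) → ℝ) 0 ∂halfLinePi m

theorem fredholmCoeff_eq (k : ℝ → ℝ → ℝ) (n : ℕ) :
    fredholmCoeff k n = ∫ y, (kMatrix k y).det ∂halfLinePi n := by
  rw [fredholmCoeff, restrict_pi_Ioi]
  rfl

theorem fredholmCoeff_zero (k : ℝ → ℝ → ℝ) : fredholmCoeff k 0 = 1 := by
  rw [fredholmCoeff_eq]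
  simp [measureReal_def]

section

variable {k : ℝ → ℝ → ℝ} {a : ℝ → ℝ}

/-- Deleting the border leaves the matrix at `y`, so `det_bordered` expresses the determinant
through the same objects with one point fewer. This is the germ of the resolvent recursion. -/
theorem rowDet_cons (m : ℕ) (x : ℝ) (y : Fin m → ℝ) :
    rowDet k a (Fin.cons x y : Fin (m + 1) → ℝ) 0 =
      a x * (kMatrix k y).det - ∑ i, k (y i) x * rowDet k a y i := by
  have h : ((kMatrix k (Fin.cons x y : Fin (m + 1) → ℝ)).updateRow 0
      fun j => a ((Fin.cons x y : Fin (m + 1) → ℝ) j)).submatrix Fin.succ Fin.succ =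
      kMatrix k y := by
    ext i j
    simp [kMatrix]
  rw [rowDet, det_bordered, h]
  simp [rowDet, kMatrix, Matrix.updateRow_apply]

theorem borderedCoeff_zero (x : ℝ) : borderedCoeff k a 0 x = a x := by
  simp [borderedCoeff, rowDet, measureReal_def, Matrix.updateRow_apply]

theorem rowDet_comp_perm {n : ℕ} (σ : Equiv.Perm (Fin n)) (y : Fin n → ℝ) (i : Fin n) :
    rowDet k a (fun j => y (σ j)) i = rowDet k a y (σ i) := by
  rw [rowDet, rowDet, ← Matrix.det_submatrix_equiv_self σ ((kMatrix k y).updateRow (σ i) _)]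
  congr 1
  ext p q
  simp [Matrix.updateRow_apply, kMatrix]

theorem integral_halfLinePi_perm {n : ℕ} (σ : Equiv.Perm (Fin n)) (F : (Fin n → ℝ) → ℝ) :
    ∫ y, F (fun j => y (σ j)) ∂halfLinePi n = ∫ y, F y ∂halfLinePi n := by
  have h := (measurePreserving_piCongrLeft (α := fun _ : Fin n => ℝ)
    (fun _ : Fin n => halfLine) σ.symm).integral_comp' F
  rw [← h]
  congr 1
  funext y
  congr 1
  funext j
  have := Equiv.piCongrLeft_apply_apply (P := fun _ : Fin n => ℝ) (e := σ.symm) y (σ j)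
  rw [MeasurableEquiv.coe_piCongrLeft]
  simpa using this.symm

/-- Swapping two variables permutes rows and columns simultaneously, so all rows contribute equally;
hence the factor `m + 1` later. -/
theorem integral_mul_rowDet (h : ℝ → ℝ) {n : ℕ} (i : Fin (n + 1)) :
    ∫ y, h (y i) * rowDet k a y i ∂halfLinePi (n + 1) =
      ∫ y, h (y 0) * rowDet k a y 0 ∂halfLinePi (n + 1) := by
  rw [← integral_halfLinePi_perm (Equiv.swap 0 i) fun y => h (y 0) * rowDet k a y 0]
  congr 1
  funext y
  simp only [rowDet_comp_perm, Equiv.swap_apply_left]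

theorem measurable_kMatrix_det (hk : Measurable (Function.uncurry k)) (n : ℕ) :
    Measurable fun y : Fin n → ℝ => (kMatrix k y).det := by
  simp only [Matrix.det_apply, kMatrix, Matrix.of_apply]
  refine Finset.measurable_sum _ fun σ _ => (Finset.measurable_prod _ fun i _ => ?_).const_smul _
  exact hk.comp (by fun_prop : Measurable fun y : Fin n → ℝ => (y (σ i), y i))

theorem measurable_rowDet (hk : Measurable (Function.uncurry k)) (ha : Measurable a) {n : ℕ}
    (i : Fin n) : Measurable fun y : Fin n → ℝ => rowDet k a y i := by
  simp only [rowDet, Matrix.det_apply, kMatrix, Matrix.of_apply, Matrix.updateRow_apply]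
  refine Finset.measurable_sum _ fun σ _ => (Finset.measurable_prod _ fun j _ => ?_).const_smul _
  split_ifs
  · exact ha.comp (measurable_pi_apply j)
  · exact hk.comp (by fun_prop : Measurable fun y : Fin n → ℝ => (y (σ j), y j))

end

/-- A kernel and a function on `ℝ₊` with the exponential bounds `|k(x, y)| ≤ C e^{-cy}` and
`|a(y)| ≤ C e^{-cy}`. -/
structure ExpBounded (k : ℝ → ℝ → ℝ) (a : ℝ → ℝ) (C c : ℝ) : Prop where
  pos : 0 < C
  rate_pos : 0 < c
  measurable_kernel : Measurable (Function.uncurry k)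
  measurable_fun : Measurable a
  kernel_le : ∀ x y, 0 < x → 0 < y → |k x y| ≤ C * Real.exp (-c * y)
  fun_le : ∀ y, 0 < y → |a y| ≤ C * Real.exp (-c * y)

theorem integral_halfLine_exp {c : ℝ} (hc : 0 < c) :
    ∫ x, Real.exp (-c * x) ∂halfLine = c⁻¹ := by
  rw [integral_exp_mul_Ioi (by linarith)]
  simp [neg_div_neg_eq]

theorem integrable_prod_exp {c : ℝ} (hc : 0 < c) (n : ℕ) :
    Integrable (fun y : Fin n → ℝ => ∏ i, Real.exp (-c * y i)) (halfLinePi n) :=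
  Integrable.fintype_prod (f := fun _ x => Real.exp (-c * x)) fun _ => exp_neg_integrableOn_Ioi 0 hc

theorem integral_prod_exp {c : ℝ} (hc : 0 < c) (n : ℕ) :
    ∫ y : Fin n → ℝ, ∏ i, Real.exp (-c * y i) ∂(halfLinePi n) = c⁻¹ ^ n := by
  rw [integral_fintype_prod_eq_pow (fun x => Real.exp (-c * x)), integral_halfLine_exp hc,
    Fintype.card_fin]

namespace ExpBounded

variable {k : ℝ → ℝ → ℝ} {a : ℝ → ℝ} {C c : ℝ}

/-- Decay in the column variable alone suffices: Hadamard's bound pulls out one exponential per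
column. -/
theorem abs_det_le (H : ExpBounded k a C c) {n : ℕ} {y : Fin n → ℝ} (hy : ∀ i, 0 < y i) :
    |(kMatrix k y).det| ≤ (C * √n) ^ n * ∏ j, Real.exp (-c * y j) :=
  abs_det_le_of_entry_le H.pos.le (fun _ => (Real.exp_pos _).le)
    fun i j => H.kernel_le _ _ (hy i) (hy j)

theorem abs_rowDet_le (H : ExpBounded k a C c) {n : ℕ} {y : Fin n → ℝ} (hy : ∀ i, 0 < y i)
    (i : Fin n) :
    |rowDet k a y i| ≤ (C * √n) ^ n * ∏ j, Real.exp (-c * y j) := by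
  refine abs_det_le_of_entry_le H.pos.le (fun _ => (Real.exp_pos _).le) fun p q => ?_
  rw [Matrix.updateRow_apply]
  split_ifs
  · exact H.fun_le _ (hy q)
  · exact H.kernel_le _ _ (hy p) (hy q)

theorem integrable_det (H : ExpBounded k a C c) (n : ℕ) :
    Integrable (fun y : Fin n → ℝ => (kMatrix k y).det) (halfLinePi n) := by
  refine ((integrable_prod_exp H.rate_pos n).const_mul ((C * √n) ^ n)).mono'
    (measurable_kMatrix_det H.measurable_kernel n).aestronglyMeasurable ?_
  filter_upwards [ae_halfLinePi_pos n] with y hy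
  exact H.abs_det_le hy

theorem abs_fredholmCoeff_le (H : ExpBounded k a C c) (n : ℕ) :
    |fredholmCoeff k n| ≤ (C * c⁻¹ * √n) ^ n := by
  rw [fredholmCoeff_eq, ← Real.norm_eq_abs]
  refine (norm_integral_le_of_norm_le
    ((integrable_prod_exp H.rate_pos n).const_mul ((C * √n) ^ n)) ?_).trans (le_of_eq ?_)
  · filter_upwards [ae_halfLinePi_pos n] with y hy
    exact H.abs_det_le hy
  · rw [integral_const_mul, integral_prod_exp H.rate_pos, ← mul_pow]
    ring

theorem integrable_mul_rowDet (H : ExpBounded k a C c) {h : ℝ → ℝ}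
    (hm : Measurable h) {M : ℝ}
    (hb : ∀ x, 0 < x → |h x| ≤ M) {n : ℕ} (i : Fin n) :
    Integrable (fun y => h (y i) * rowDet k a y i) (halfLinePi n) := by
  refine ((integrable_prod_exp H.rate_pos n).const_mul (M * (C * √n) ^ n)).mono' ?_ ?_
  · exact ((hm.comp (measurable_pi_apply i)).mul
      (measurable_rowDet H.measurable_kernel H.measurable_fun i)).aestronglyMeasurable
  filter_upwards [ae_halfLinePi_pos n] with y hy
  rw [Real.norm_eq_abs, abs_mul, mul_assoc]
  exact mul_le_mul (hb _ (hy i)) (H.abs_rowDet_le hy i) (abs_nonneg _)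
    ((abs_nonneg _).trans (hb _ (hy i)))

theorem integral_mul_rowDet_zero (H : ExpBounded k a C c) {h : ℝ → ℝ}
    (hm : Measurable h) {M : ℝ}
    (hb : ∀ x, 0 < x → |h x| ≤ M) (m : ℕ) :
    ∫ y, h (y 0) * rowDet k a y 0 ∂halfLinePi (m + 1) =
      ∫ x, h x * borderedCoeff k a m x ∂halfLine := by
  have hi := H.integrable_mul_rowDet hm hb (0 : Fin (m + 1))
  have hp := (measurePreserving_piFinSuccAbove (fun _ : Fin (m + 1) => halfLine) 0).symm
  rw [← hp.integrable_comp_emb (MeasurableEquiv.measurableEmbedding _)] at hi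
  rw [← hp.integral_comp']
  refine (integral_prod _ hi).trans ?_
  congr 1
  funext x
  rw [borderedCoeff, ← integral_const_mul]
  simp [MeasurableEquiv.piFinSuccAbove_symm_apply, Fin.insertNthEquiv]

theorem sum_integral_mul_rowDet (H : ExpBounded k a C c) {h : ℝ → ℝ}
    (hm : Measurable h) {M : ℝ}
    (hb : ∀ x, 0 < x → |h x| ≤ M) (m : ℕ) :
    ∫ y, ∑ i, h (y i) * rowDet k a y i ∂halfLinePi (m + 1) =
      (m + 1) * ∫ x, h x * borderedCoeff k a m x ∂halfLine := by
  rw [integral_finsetSum _ fun i _ => H.integrable_mul_rowDet hm hb i]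
  simp only [integral_mul_rowDet]
  rw [Finset.sum_const, H.integral_mul_rowDet_zero hm hb]
  simp

/-- Integrating `rowDet_cons` gives the coefficientwise form of $(I-K)E=\mathrm{Det}(I-K)\,a$. -/
theorem borderedCoeff_succ (H : ExpBounded k a C c) (m : ℕ) {x : ℝ} (hx : 0 < x) :
    borderedCoeff k a (m + 1) x = a x * fredholmCoeff k (m + 1) -
      (m + 1) * ∫ z, k z x * borderedCoeff k a m z ∂halfLine := by
  have hm : Measurable fun z => k z x :=
    H.measurable_kernel.comp (by fun_prop : Measurable fun z : ℝ => (z, x))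
  have hb : ∀ z, 0 < z → |k z x| ≤ C * Real.exp (-c * x) := fun z hz => H.kernel_le z x hz hx
  rw [← H.sum_integral_mul_rowDet hm hb, fredholmCoeff_eq, ← integral_const_mul, ← integral_sub,
    borderedCoeff]
  · simp only [rowDet_cons]
  · exact (H.integrable_det _).const_mul _
  · exact integrable_finsetSum _ fun i _ => H.integrable_mul_rowDet hm hb i

theorem stronglyMeasurable_borderedCoeff (H : ExpBounded k a C c) (m : ℕ) :
    StronglyMeasurable (borderedCoeff k a m) := by
  have h1 : Measurable fun p : ℝ × (Fin m → ℝ) => (Fin.cons p.1 p.2 : Fin (m + 1) → ℝ) := by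
    refine measurable_pi_lambda _ fun i => ?_
    refine Fin.cases ?_ (fun i => ?_) i
    · simpa using measurable_fst
    · simpa [Function.comp_def] using (measurable_pi_apply i).comp measurable_snd
  have h := (measurable_rowDet H.measurable_kernel H.measurable_fun (0 : Fin (m + 1))).comp h1
  exact h.stronglyMeasurable.integral_prod_right' (ν := halfLinePi m)

theorem abs_borderedCoeff_le (H : ExpBounded k a C c) (m : ℕ) {x : ℝ} (hx : 0 < x) :
    |borderedCoeff k a m x| ≤
      (C * √(m + 1 : ℕ)) ^ (m + 1) * c⁻¹ ^ m * Real.exp (-c * x) := by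
  rw [borderedCoeff, ← Real.norm_eq_abs]
  refine (norm_integral_le_of_norm_le
    ((integrable_prod_exp H.rate_pos m).const_mul
      ((C * √(m + 1 : ℕ)) ^ (m + 1) * Real.exp (-c * x))) ?_).trans (le_of_eq ?_)
  · filter_upwards [ae_halfLinePi_pos m] with y hy
    have := H.abs_rowDet_le (y := (Fin.cons x y : Fin (m + 1) → ℝ))
      (fun i => Fin.cases (by simpa using hx) (fun i => by simpa using hy i) i) 0
    rw [Fin.prod_univ_succ] at this
    simpa [mul_assoc] using this
  · rw [integral_const_mul, integral_prod_exp H.rate_pos]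
    ring

theorem memLp_borderedCoeff (H : ExpBounded k a C c) (m : ℕ) :
    MemLp (borderedCoeff k a m) 2 halfLine := by
  refine ((memLp_exp H.rate_pos).const_mul ((C * √(m + 1 : ℕ)) ^ (m + 1) * c⁻¹ ^ m)).mono'
    (H.stronglyMeasurable_borderedCoeff m).aestronglyMeasurable ?_
  filter_upwards [ae_restrict_mem measurableSet_Ioi] with x hx
  exact H.abs_borderedCoeff_le m hx

end ExpBounded

/-! ### The Fredholm series -/

theorem memLp_of_expBound {a : ℝ → ℝ} (ha : Measurable a) {C c : ℝ} (hc : 0 < c)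
    (hb : ∀ y, 0 < y → |a y| ≤ C * Real.exp (-c * y)) : MemLp a 2 halfLine := by
  refine ((memLp_exp hc).const_mul C).mono' ha.aestronglyMeasurable ?_
  filter_upwards [ae_restrict_mem measurableSet_Ioi] with x hx
  exact hb x hx

/-- The summands of the Fredholm determinant, starting from the constant term. -/
def fredholmTerm (k : ℝ → ℝ → ℝ) (n : ℕ) : ℝ :=
  (-1) ^ n / (n.factorial : ℝ) * fredholmCoeff k n

theorem abs_neg_one_pow_div_factorial (n : ℕ) :
    |(-1 : ℝ) ^ n / (n.factorial : ℝ)| = 1 / (n.factorial : ℝ) := by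
  rw [abs_div, abs_pow, abs_neg, abs_one, one_pow, Nat.abs_cast]

namespace ExpBounded

variable {k : ℝ → ℝ → ℝ} {a : ℝ → ℝ} {C c : ℝ}

theorem mono (H : ExpBounded k a C c) {C' : ℝ} (h : C ≤ C') : ExpBounded k a C' c where
  pos := H.pos.trans_le h
  rate_pos := H.rate_pos
  measurable_kernel := H.measurable_kernel
  measurable_fun := H.measurable_fun
  kernel_le x y hx hy := (H.kernel_le x y hx hy).trans (by gcongr)
  fun_le y hy := (H.fun_le y hy).trans (by gcongr)

theorem memLp_fun (H : ExpBounded k a C c) : MemLp a 2 halfLine :=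
  memLp_of_expBound H.measurable_fun H.rate_pos H.fun_le

theorem abs_fredholmTerm_le (H : ExpBounded k a C c) (n : ℕ) :
    |fredholmTerm k n| ≤ (C * c⁻¹ * √n) ^ n / n.factorial := by
  rw [fredholmTerm, abs_mul, abs_neg_one_pow_div_factorial, div_mul_eq_mul_div, one_mul]
  gcongr
  exact H.abs_fredholmCoeff_le n

theorem summable_fredholmTerm (H : ExpBounded k a C c) : Summable (fredholmTerm k) :=
  Summable.of_norm_bounded (summable_hadamard (C * c⁻¹)) H.abs_fredholmTerm_le

theorem fredholmSeriesConverges (H : ExpBounded k a C c) : FredholmSeriesConverges k := by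
  refine ⟨fun n => ?_, (summable_nat_add_iff 1).2 H.summable_fredholmTerm⟩
  rw [IntegrableOn, restrict_pi_Ioi]
  exact H.integrable_det n

theorem fredholmDet_eq_tsum (H : ExpBounded k a C c) :
    fredholmDet k = ∑' n, fredholmTerm k n := by
  rw [H.summable_fredholmTerm.tsum_eq_zero_add, fredholmDet]
  simp [fredholmTerm, fredholmCoeff_zero]

/-- The functions `borderedCoeff k a m` as elements of `L²(ℝ₊)`. -/
def borderedVec (H : ExpBounded k a C c) (m : ℕ) : L2 :=
  (H.memLp_borderedCoeff m).toLp _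

theorem norm_borderedVec_le (H : ExpBounded k a C c) (m : ℕ) :
    ‖H.borderedVec m‖ ≤
      (C * √(m + 1 : ℕ)) ^ (m + 1) * c⁻¹ ^ m * ‖(memLp_exp H.rate_pos).toLp _‖ := by
  have h0 : 0 ≤ (C * √(m + 1 : ℕ)) ^ (m + 1) * c⁻¹ ^ m := by
    have := H.pos
    have := H.rate_pos
    positivity
  have h1 : ‖H.borderedVec m‖ ≤ ‖((memLp_exp H.rate_pos).const_mul
      ((C * √(m + 1 : ℕ)) ^ (m + 1) * c⁻¹ ^ m)).toLp _‖ :=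
    norm_toLp_le _ _ fun x hx => H.abs_borderedCoeff_le m hx
  have h2 : ((memLp_exp H.rate_pos).const_mul
      ((C * √(m + 1 : ℕ)) ^ (m + 1) * c⁻¹ ^ m)).toLp _ =
      ((C * √(m + 1 : ℕ)) ^ (m + 1) * c⁻¹ ^ m) • (memLp_exp H.rate_pos).toLp _ := by
    rw [← MemLp.toLp_const_smul]
    rfl
  rwa [h2, norm_smul, Real.norm_of_nonneg h0] at h1

theorem summable_borderedVec (H : ExpBounded k a C c) :
    Summable fun m : ℕ => ((-1 : ℝ) ^ m / (m.factorial : ℝ)) • H.borderedVec m := by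
  have hC := H.pos
  have hc := H.rate_pos
  -- Since $1/m!=(m+1)/(m+1)!$, the bound is the shifted term of this series; the extra `c` turns
  -- $c^{-(m+1)}$ into $c^{-m}$.
  have h1 := ((summable_nat_add_iff 1).2 (summable_mul_hadamard
    (x := C * c⁻¹) (by positivity))).mul_right (c * ‖(memLp_exp H.rate_pos).toLp _‖)
  refine Summable.of_norm_bounded h1 fun m => ?_
  rw [norm_smul, Real.norm_eq_abs, abs_neg_one_pow_div_factorial]
  refine (mul_le_mul_of_nonneg_left (H.norm_borderedVec_le m) (by positivity)).trans (le_of_eq ?_)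
  generalize ‖(memLp_exp H.rate_pos).toLp _‖ = L
  rw [Nat.factorial_succ, mul_right_comm C, mul_pow (C * √_), pow_succ c⁻¹ m]
  push_cast
  field_simp

theorem borderedVec_zero (H : ExpBounded k a C c) : H.borderedVec 0 = H.memLp_fun.toLp a :=
  MemLp.toLp_congr _ _ (ae_of_all _ fun x => borderedCoeff_zero x)

theorem borderedVec_succ (H : ExpBounded k a C c)
    (hk : MemLp (Function.uncurry k) 2 (halfLine.prod halfLine))
    (hsymm : ∀ x y, k x y = k y x) (m : ℕ) :
    H.borderedVec (m + 1) = fredholmCoeff k (m + 1) • H.memLp_fun.toLp a -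
      ((m : ℝ) + 1) • kernelOperator k hk (H.borderedVec m) := by
  refine Lp.ext ?_
  filter_upwards [(H.memLp_borderedCoeff (m + 1)).coeFn_toLp, H.memLp_fun.coeFn_toLp,
    kernelOperator_apply_ae hk (H.borderedVec m), ae_restrict_mem measurableSet_Ioi,
    Lp.coeFn_sub (fredholmCoeff k (m + 1) • H.memLp_fun.toLp a)
      (((m : ℝ) + 1) • kernelOperator k hk (H.borderedVec m)),
    Lp.coeFn_smul (fredholmCoeff k (m + 1)) (H.memLp_fun.toLp a),
    Lp.coeFn_smul ((m : ℝ) + 1) (kernelOperator k hk (H.borderedVec m))]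
    with x h1 h2 h3 hx h4 h5 h6
  rw [borderedVec, h1, h4, Pi.sub_apply, h5, h6, Pi.smul_apply, Pi.smul_apply, h2, h3,
    H.borderedCoeff_succ m hx, smul_eq_mul, smul_eq_mul, mul_comm (a x)]
  congr 2
  refine integral_congr_ae ?_
  filter_upwards [(H.memLp_borderedCoeff m).coeFn_toLp] with z hz
  rw [borderedVec, hz, hsymm]

/-- The generating series of the bordered coefficients solves `(1 - K) E = Det(1 - K) a`. -/
theorem one_sub_kernelOperator_tsum (H : ExpBounded k a C c)
    (hk : MemLp (Function.uncurry k) 2 (halfLine.prod halfLine))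
    (hsymm : ∀ x y, k x y = k y x) :
    (1 - kernelOperator k hk) (∑' m : ℕ, ((-1 : ℝ) ^ m / (m.factorial : ℝ)) • H.borderedVec m) =
      fredholmDet k • H.memLp_fun.toLp a := by
  have hs := H.summable_borderedVec
  have hK : Summable fun m : ℕ =>
      kernelOperator k hk (((-1 : ℝ) ^ m / (m.factorial : ℝ)) • H.borderedVec m) :=
    hs.map (kernelOperator k hk) (kernelOperator k hk).continuous
  have hD := (summable_nat_add_iff 1).2 H.summable_fredholmTerm
  -- The factor `m + 1` of the recursion cancels in the factorial, and summation gives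
  -- $E=\mathrm{Det}\cdot a+KE$.
  have e : ∀ m : ℕ, ((-1 : ℝ) ^ (m + 1) / ((m + 1).factorial : ℝ)) • H.borderedVec (m + 1) =
      fredholmTerm k (m + 1) • H.memLp_fun.toLp a +
        kernelOperator k hk (((-1 : ℝ) ^ m / (m.factorial : ℝ)) • H.borderedVec m) := by
    intro m
    rw [H.borderedVec_succ hk hsymm, smul_sub, smul_smul, smul_smul, fredholmTerm, sub_eq_add_neg,
      ← neg_smul, map_smul]
    congr 2
    rw [Nat.factorial_succ, pow_succ]
    push_cast
    field_simp
  rw [sub_apply, one_apply_eq_self, sub_eq_iff_eq_add,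
    ContinuousLinearMap.map_tsum _ hs, hs.tsum_eq_zero_add]
  simp only [e]
  rw [(hD.smul_const _).tsum_add hK, hD.tsum_smul_const, H.fredholmDet_eq_tsum,
    H.summable_fredholmTerm.tsum_eq_zero_add, H.borderedVec_zero, add_smul, ← add_assoc]
  simp [fredholmTerm, fredholmCoeff_zero]

/-- Minus the derivative of `fredholmCoeff` under a change of the kernel in the direction
`-a ⊗ a`. -/
def variation (k : ℝ → ℝ → ℝ) (a : ℝ → ℝ) (n : ℕ) : ℝ :=
  ∫ y, ∑ i, a (y i) * rowDet k a y i ∂halfLinePi n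

theorem abs_fun_le (H : ExpBounded k a C c) {x : ℝ} (hx : 0 < x) : |a x| ≤ C := by
  refine (H.fun_le x hx).trans (mul_le_of_le_one_right H.pos.le (Real.exp_le_one_iff.2 ?_))
  nlinarith [H.rate_pos]

theorem abs_sum_rowDet_le (H : ExpBounded k a C c) {n : ℕ} {y : Fin n → ℝ} (hy : ∀ i, 0 < y i) :
    |∑ i, a (y i) * rowDet k a y i| ≤
      n * C * (C * √n) ^ n * ∏ j, Real.exp (-c * y j) := by
  refine (Finset.abs_sum_le_sum_abs _ _).trans ?_
  have h : ∀ i ∈ (Finset.univ : Finset (Fin n)), |a (y i) * rowDet k a y i| ≤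
      C * ((C * √n) ^ n * ∏ j, Real.exp (-c * y j)) := fun i _ => by
    rw [abs_mul]
    exact mul_le_mul (H.abs_fun_le (hy i)) (H.abs_rowDet_le hy i) (abs_nonneg _) H.pos.le
  refine (Finset.sum_le_sum h).trans (le_of_eq ?_)
  rw [Finset.sum_const, Finset.card_univ, Fintype.card_fin, nsmul_eq_mul]
  ring

theorem abs_variation_le (H : ExpBounded k a C c) (n : ℕ) :
    |variation k a n| ≤ n * C * (C * c⁻¹ * √n) ^ n := by
  rw [variation, ← Real.norm_eq_abs]
  refine (norm_integral_le_of_norm_le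
    ((integrable_prod_exp H.rate_pos n).const_mul (n * C * (C * √n) ^ n)) ?_).trans (le_of_eq ?_)
  · filter_upwards [ae_halfLinePi_pos n] with y hy
    exact H.abs_sum_rowDet_le hy
  · rw [integral_const_mul, integral_prod_exp H.rate_pos, mul_assoc, ← mul_pow]
    ring

theorem variation_succ (H : ExpBounded k a C c) (m : ℕ) :
    variation k a (m + 1) = (m + 1) * inner ℝ (H.memLp_fun.toLp a) (H.borderedVec m) := by
  rw [variation, H.sum_integral_mul_rowDet H.measurable_fun fun x hx => H.abs_fun_le hx,
    borderedVec, inner_toLp_toLp]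

end ExpBounded

/-! ### Differentiation of the Fredholm determinant -/

theorem kKernel_symm (A : ℝ → ℝ) (s x y : ℝ) : kKernel A s x y = kKernel A s y x := by
  simp only [kKernel, mul_comm]

theorem kKernel_translate (A : ℝ → ℝ) (S s x y : ℝ) :
    kKernel A s x y = kKernel A S (x + (s - S)) (y + (s - S)) := by
  simp only [kKernel, aKernel]
  congr 1
  funext r
  congr 2 <;> ring

theorem Admissible.exists_expBounded (hA : Admissible A) (S : ℝ) :
    ∃ C c : ℝ, 0 < C ∧ 0 < c ∧ ∀ s, S ≤ s →
      ExpBounded (kKernel A s) (fun x => aKernel A s x 0) (C * Real.exp (-c * (s - S))) c := by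
  obtain ⟨C₁, c₁, hC₁, hc₁, hb₁⟩ := hA.exists_uniform_bound S
  obtain ⟨C₂, c₂, hC₂, hc₂, hb₂⟩ := hA.exists_kKernel_bound S
  refine ⟨max C₁ C₂, min c₁ c₂, lt_max_of_lt_left hC₁, lt_min hc₁ hc₂, fun s hs => ⟨?_, ?_, ?_, ?_,
    ?_, ?_⟩⟩
  · have : 0 < max C₁ C₂ := lt_max_of_lt_left hC₁
    positivity
  · exact lt_min hc₁ hc₂
  · exact (stronglyMeasurable_kKernel hA s).measurable
  · exact ((continuous_aKernel hA s).comp (by fun_prop :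
      Continuous fun x : ℝ => (x, (0 : ℝ)))).measurable
  · intro x y hx hy
    have hs' : 0 ≤ s - S := sub_nonneg.2 hs
    rw [kKernel_translate A S]
    refine (hb₂ _ _ (by positivity) (by positivity)).trans ?_
    rw [mul_add, mul_add, Real.exp_add, Real.exp_add]
    -- The decay in `x` is discarded; one factor in `s - S` is kept, since it forces the determinant
    -- to $1$ at $+\infty$.
    have h1 : Real.exp (-c₂ * x) * Real.exp (-c₂ * (s - S)) ≤ 1 := by
      rw [← Real.exp_add]
      exact Real.exp_le_one_iff.2 (by nlinarith [mul_nonneg hc₂.le hx.le, mul_nonneg hc₂.le hs'])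
    calc C₂ * (Real.exp (-c₂ * x) * Real.exp (-c₂ * (s - S)) *
          (Real.exp (-c₂ * y) * Real.exp (-c₂ * (s - S))))
        ≤ C₂ * (1 * (Real.exp (-c₂ * y) * Real.exp (-c₂ * (s - S)))) := by gcongr
      _ ≤ max C₁ C₂ * (1 * (Real.exp (-min c₁ c₂ * y) * Real.exp (-min c₁ c₂ * (s - S)))) := by
          gcongr
          · exact le_max_right _ _
          · exact min_le_right _ _
          · exact min_le_right _ _
      _ = _ := by ring
  · intro y hy
    have hs' : 0 ≤ s - S := sub_nonneg.2 hs
    rw [aKernel, add_zero]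
    refine (hb₁ s hs y hy.le).trans ?_
    gcongr
    · exact le_max_left _ _
    · exact min_le_left _ _
    · exact min_le_left _ _

theorem Admissible.exists_expBounded_uniform (hA : Admissible A) (S : ℝ) :
    ∃ C c : ℝ, 0 < C ∧ 0 < c ∧ ∀ s, S ≤ s →
      ExpBounded (kKernel A s) (fun x => aKernel A s x 0) C c := by
  obtain ⟨C, c, hC, hc, H⟩ := hA.exists_expBounded S
  refine ⟨C, c, hC, hc, fun s hs => (H s hs).mono (mul_le_of_le_one_right hC.le ?_)⟩
  exact Real.exp_le_one_iff.2 (by nlinarith)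

theorem hasDerivAt_kKernel (hA : Admissible A) (s x y : ℝ) :
    HasDerivAt (fun t => kKernel A t x y) (-(aKernel A s x 0 * aKernel A s y 0)) s := by
  have hcont := hA.smooth.continuous
  have hi : ∀ s, IntegrableOn (fun r => A (x + r) * A (y + r)) (Ioi s) := fun s => by
    obtain ⟨C, c, hC, hc, hb⟩ := hA.exists_abs_le (x + s)
    obtain ⟨C', c', hC', hc', hb'⟩ := hA.exists_abs_le (y + s)
    refine exp_decay_integrableOn (by fun_prop) (C := C * C') (c := c + c') (by positivity)
      fun r hr => ?_
    rw [norm_mul, Real.norm_eq_abs, Real.norm_eq_abs]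
    refine (mul_le_mul (hb (x + r) (by linarith)) (hb' (y + r) (by linarith)) (abs_nonneg _)
      (by positivity)).trans (le_of_eq ?_)
    rw [mul_mul_mul_comm, ← Real.exp_add]
    congr 2
    ring
  have h := hasDerivAt_integral_Ioi (F := fun r => A (x + r) * A (y + r)) (by fun_prop) hi s
  simp only [aKernel, add_zero]
  refine h.congr_of_eventuallyEq (Eventually.of_forall fun t => ?_)
  have h2 := integral_Ioi_comp_add_right (fun r => A (x + r) * A (y + r)) 0 t
  rw [zero_add] at h2
  simpa only [kKernel, aKernel, add_assoc] using h2

/-- Leibniz rule for the determinant as a multilinear function of its rows. -/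
theorem hasDerivAt_det {n : ℕ} {M : ℝ → Matrix (Fin n) (Fin n) ℝ} {M' : Matrix (Fin n) (Fin n) ℝ}
    {s : ℝ} (h : ∀ i j, HasDerivAt (fun t => M t i j) (M' i j) s) :
    HasDerivAt (fun t => (M t).det) (∑ i, ((M s).updateRow i (M' i)).det) s := by
  let f : ContinuousMultilinearMap ℝ (fun _ : Fin n => Fin n → ℝ) ℝ :=
    { (Matrix.detRowAlternating (n := Fin n) (R := ℝ)).toMultilinearMap with
      cont := Continuous.matrix_det (A := fun m : Fin n → Fin n → ℝ => Matrix.of m) continuous_id }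
  have hrow : ∀ i, HasDerivAt (fun t => M t i) (M' i) s := fun i => hasDerivAt_pi.2 (h i)
  have h1 := HasFDerivAt.multilinear_comp (f := f) fun i => (hrow i).hasFDerivAt
  have h2 := h1.hasDerivAt
  refine h2.congr_deriv ?_
  simp only [sum_apply, ContinuousLinearMap.comp_apply]
  refine Finset.sum_congr rfl fun i _ => ?_
  simp
  rfl

theorem hasDerivAt_kMatrix_det (hA : Admissible A) (s : ℝ) {n : ℕ} (y : Fin n → ℝ) :
    HasDerivAt (fun t => (kMatrix (kKernel A t) y).det)
      (-∑ i, aKernel A s (y i) 0 * rowDet (kKernel A s) (fun x => aKernel A s x 0) y i) s := by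
  refine (hasDerivAt_det (M := fun t => kMatrix (kKernel A t) y)
    fun i j => hasDerivAt_kKernel hA s (y i) (y j)).congr_deriv ?_
  rw [← Finset.sum_neg_distrib]
  refine Finset.sum_congr rfl fun i _ => ?_
  have : (fun j => -(aKernel A s (y i) 0 * aKernel A s (y j) 0)) =
      (-aKernel A s (y i) 0) • fun j => aKernel A s (y j) 0 := by
    funext j
    simp
  rw [this, Matrix.det_updateRow_smul, rowDet, neg_mul]

theorem hasDerivAt_fredholmCoeff (hA : Admissible A) (s : ℝ) (n : ℕ) :
    HasDerivAt (fun t => fredholmCoeff (kKernel A t) n)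
      (-ExpBounded.variation (kKernel A s) (fun x => aKernel A s x 0) n) s := by
  obtain ⟨C, c, hC, hc, H⟩ := hA.exists_expBounded_uniform (s - 1)
  have Hs := H s (by linarith)
  simp only [fredholmCoeff_eq, ExpBounded.variation, ← integral_neg]
  refine (hasDerivAt_integral_of_dominated_loc_of_deriv_le
    (F := fun t (y : Fin n → ℝ) => (kMatrix (kKernel A t) y).det)
    (F' := fun t y => -∑ i, aKernel A t (y i) 0 *
      rowDet (kKernel A t) (fun x => aKernel A t x 0) y i)
    (bound := fun y => n * C * (C * √n) ^ n * ∏ j, Real.exp (-c * y j))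
    (Ioi_mem_nhds (show s - 1 < s by linarith)) ?_ (Hs.integrable_det n) ?_ ?_ ?_ ?_).2
  · filter_upwards [Ioi_mem_nhds (show s - 1 < s by linarith)] with t ht
    exact (measurable_kMatrix_det (H t (le_of_lt ht)).measurable_kernel n).aestronglyMeasurable
  · refine (Measurable.neg (Finset.measurable_sum _ fun i _ => ?_)).aestronglyMeasurable
    exact (Hs.measurable_fun.comp (measurable_pi_apply i)).mul
      (measurable_rowDet Hs.measurable_kernel Hs.measurable_fun i)
  · filter_upwards [ae_halfLinePi_pos n] with y hy t ht
    rw [norm_neg]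
    exact (H t (le_of_lt ht)).abs_sum_rowDet_le hy
  · exact (integrable_prod_exp hc n).const_mul _
  · exact ae_of_all _ fun y t _ => hasDerivAt_kMatrix_det hA t y

theorem resolvent_mul (hA : Admissible A) (s : ℝ) : resolvent hA s * (1 - kOp hA s) = 1 :=
  Ring.inverse_mul_cancel _ (isUnit_one_sub_kOp hA s)

theorem mul_resolvent (hA : Admissible A) (s : ℝ) : (1 - kOp hA s) * resolvent hA s = 1 :=
  Ring.mul_inverse_cancel _ (isUnit_one_sub_kOp hA s)

/-- The term $n=0$ vanishes and the term $n=m+1$ is $\frac{(-1)^m}{m!}\langle a,B_m\rangle$, with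
$B_m$ the bordered vector. -/
theorem ExpBounded.hasSum_variation {k : ℝ → ℝ → ℝ} {a : ℝ → ℝ} {C c : ℝ}
    (H : ExpBounded k a C c) :
    HasSum (fun n : ℕ => (-1 : ℝ) ^ n / (n.factorial : ℝ) * -ExpBounded.variation k a n)
      (inner ℝ (H.memLp_fun.toLp a)
        (∑' m : ℕ, ((-1 : ℝ) ^ m / (m.factorial : ℝ)) • H.borderedVec m)) := by
  have hterm : ∀ n : ℕ, (-1 : ℝ) ^ (n + 1) / ((n + 1).factorial : ℝ) *
      -ExpBounded.variation k a (n + 1) =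
      inner ℝ (H.memLp_fun.toLp a) (((-1 : ℝ) ^ n / (n.factorial : ℝ)) • H.borderedVec n) := by
    intro n
    rw [H.variation_succ, inner_smul_right, Nat.factorial_succ, pow_succ]
    push_cast
    field_simp
  have h0 : ExpBounded.variation k a 0 = 0 := by simp [ExpBounded.variation]
  have h1 : HasSum (fun n : ℕ =>
      inner ℝ (H.memLp_fun.toLp a) (((-1 : ℝ) ^ n / (n.factorial : ℝ)) • H.borderedVec n))
      (inner ℝ (H.memLp_fun.toLp a)
        (∑' m : ℕ, ((-1 : ℝ) ^ m / (m.factorial : ℝ)) • H.borderedVec m)) :=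
    H.summable_borderedVec.hasSum.mapL (innerSL ℝ (H.memLp_fun.toLp a))
  rw [← hasSum_nat_add_iff' 1]
  simpa only [Finset.sum_range_one, h0, neg_zero, mul_zero, sub_zero, hterm] using h1

/-- Termwise differentiation gives $\langle a_s,E\rangle$, and applying the resolvent to the
equation for $E$ gives $E=\mathrm{Det}\cdot R_sa_s$. Nothing is divided by the determinant, whose
sign is not yet known. -/
theorem hasDerivAt_fredholmDet (hA : Admissible A) (s : ℝ) :
    HasDerivAt (fun t => fredholmDet (kKernel A t))
      (fredholmDet (kKernel A s) * u₀ hA s) s := by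
  obtain ⟨C, c, hC, hc, H⟩ := hA.exists_expBounded_uniform (s - 1)
  have Hs := H s (by linarith)
  have hmem : s ∈ Ioi (s - 1) := by simp
  let v : ℕ → ℝ → ℝ := fun n t =>
    ExpBounded.variation (kKernel A t) (fun x => aKernel A t x 0) n
  have hd := hasDerivAt_tsum_of_isPreconnected
    (g := fun (n : ℕ) t => fredholmTerm (kKernel A t) n)
    (g' := fun (n : ℕ) t => (-1) ^ n / (n.factorial : ℝ) * -v n t)
    (u := fun n : ℕ => (n : ℝ) * (C * c⁻¹ * √n) ^ n / (n.factorial : ℝ) * C)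
    (t := Ioi (s - 1)) (y₀ := s) (y := s)
    ((summable_mul_hadamard (by positivity)).mul_right C) isOpen_Ioi isPreconnected_Ioi
    (fun n t _ => (hasDerivAt_fredholmCoeff hA t n).const_mul _)
    (fun n t ht => by
      rw [norm_mul, norm_neg, Real.norm_eq_abs, abs_neg_one_pow_div_factorial]
      have := (H t (le_of_lt ht)).abs_variation_le n
      rw [Real.norm_eq_abs]
      calc 1 / (n.factorial : ℝ) * |v n t|
          ≤ 1 / (n.factorial : ℝ) * (n * C * (C * c⁻¹ * √n) ^ n) := by gcongr
        _ = _ := by ring)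
    hmem Hs.summable_fredholmTerm hmem
  have hE := Hs.one_sub_kernelOperator_tsum (memLp_kKernel hA s) (kKernel_symm A s)
  set E := ∑' m : ℕ, ((-1 : ℝ) ^ m / (m.factorial : ℝ)) • Hs.borderedVec m with hEdef
  have hE' : E = fredholmDet (kKernel A s) • resolvent hA s (aVec hA s) := by
    have h1 : (resolvent hA s * (1 - kOp hA s)) E =
        fredholmDet (kKernel A s) • resolvent hA s (aVec hA s) := by
      rw [← map_smul]
      exact congrArg (resolvent hA s) hE
    rwa [resolvent_mul] at h1
  have hsum : ∑' n : ℕ, (-1) ^ n / (n.factorial : ℝ) * -v n s = inner ℝ (aVec hA s) E :=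
    Hs.hasSum_variation.tsum_eq
  rw [hsum, hE', inner_smul_right] at hd
  refine hd.congr_of_eventuallyEq ?_
  filter_upwards [Ioi_mem_nhds (show s - 1 < s by linarith)] with t ht
  exact (H t (le_of_lt ht)).fredholmDet_eq_tsum

/-! ### The functions `u₀` and `q₀` -/

theorem inner_kOp_comm (hA : Admissible A) (s : ℝ) (f g : L2) :
    inner ℝ (kOp hA s f) g = inner ℝ f (kOp hA s g) :=
  inner_kernelOperator_comm _ (kKernel_symm A s) f g

theorem one_sub_kOp_resolvent (hA : Admissible A) (s : ℝ) (f : L2) :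
    resolvent hA s f - kOp hA s (resolvent hA s f) = f :=
  congrArg (fun T : L2 →L[ℝ] L2 => T f) (mul_resolvent hA s)

theorem resolvent_one_sub_kOp (hA : Admissible A) (s : ℝ) (f : L2) :
    resolvent hA s (f - kOp hA s f) = f :=
  congrArg (fun T : L2 →L[ℝ] L2 => T f) (resolvent_mul hA s)

theorem inner_resolvent_comm (hA : Admissible A) (s : ℝ) (f g : L2) :
    inner ℝ (resolvent hA s f) g = inner ℝ f (resolvent hA s g) := by
  conv_lhs => rw [← one_sub_kOp_resolvent hA s g]
  conv_rhs => rw [← one_sub_kOp_resolvent hA s f]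
  rw [inner_sub_right, inner_sub_left, inner_kOp_comm]

theorem aOp_resolvent (hA : Admissible A) (s : ℝ) (f : L2) :
    aOp hA s (resolvent hA s f) = resolvent hA s (aOp hA s f) := by
  have hcomm : ∀ g, aOp hA s (kOp hA s g) = kOp hA s (aOp hA s g) := fun g => by
    rw [← aOp_mul_aOp, ← aOp_mul_aOp]
  rw [← resolvent_one_sub_kOp hA s (aOp hA s (resolvent hA s f)), ← hcomm, ← map_sub,
    one_sub_kOp_resolvent]

/-- From $R=I+RK$, $K_s=A_s^2$ and $[A_s,R_s]=0$. This form avoids differentiating $a_s$ itself,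
which would involve $A'$, for which no decay is assumed. -/
theorem u₀_eq (hA : Admissible A) (s : ℝ) :
    u₀ hA s = ‖aVec hA s‖ ^ 2 + inner ℝ (kVec hA s) (resolvent hA s (kVec hA s)) := by
  have h : resolvent hA s (kOp hA s (aVec hA s)) = resolvent hA s (aVec hA s) - aVec hA s := by
    have := resolvent_one_sub_kOp hA s (aVec hA s)
    rw [map_sub] at this
    rw [eq_sub_iff_add_eq, ← eq_sub_iff_add_eq']
    exact this.symm
  rw [← aOp_aVec, inner_aOp_comm, aOp_resolvent, aOp_mul_aOp, h, inner_sub_right,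
    real_inner_self_eq_norm_sq, u₀]
  ring

theorem hasDerivAt_resolvent (hA : Admissible A) (s : ℝ) :
    HasDerivAt (resolvent hA) (-(resolvent hA s * aRankOne hA s * resolvent hA s)) s := by
  obtain ⟨x, hx⟩ := isUnit_one_sub_kOp hA s
  have h1 : HasDerivAt (fun t => 1 - kOp hA t) (aRankOne hA s) s := by
    simpa using (hasDerivAt_kOp hA s).const_sub 1
  have h2 := hasFDerivAt_ringInverse (𝕜 := ℝ) x
  rw [hx] at h2
  have h3 := h2.comp_hasDerivAt s h1
  have h4 : ((x⁻¹ : (L2 →L[ℝ] L2)ˣ) : L2 →L[ℝ] L2) = resolvent hA s := by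
    rw [resolvent, ← hx, Ring.inverse_unit]
  rw [h4] at h3
  exact h3

/-- With $b=\langle a_s,R_sk_s\rangle$ the three contributions are $-A(s)^2$ from the norm,
$-2A(s)b$ from the two factors $k_s$, and $-b^2$ from the resolvent: a perfect square. -/
theorem hasDerivAt_u₀ (hA : Admissible A) (s : ℝ) : HasDerivAt (u₀ hA) (-(q₀ hA s) ^ 2) s := by
  have h1 := (hasDerivAt_resolvent hA s).clm_apply (hasDerivAt_kVec hA s)
  have h2 := (hasDerivAt_norm_aVec_sq hA s).add ((hasDerivAt_kVec hA s).inner ℝ h1)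
  rw [funext (u₀_eq hA)]
  refine h2.congr_deriv ?_
  have h3 : inner ℝ (kVec hA s) (resolvent hA s (aVec hA s)) =
      inner ℝ (aVec hA s) (resolvent hA s (kVec hA s)) := by
    rw [← inner_resolvent_comm, real_inner_comm]
  have h4 : (resolvent hA s * aRankOne hA s * resolvent hA s) (kVec hA s) =
      inner ℝ (aVec hA s) (resolvent hA s (kVec hA s)) • resolvent hA s (aVec hA s) := by
    change resolvent hA s (aRankOne hA s (resolvent hA s (kVec hA s))) = _
    rw [aRankOne_apply, map_smul]
  rw [neg_apply, h4, map_neg, map_smul, inner_add_right, inner_neg_right, inner_neg_right,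
    inner_neg_left, inner_smul_left, inner_smul_right, inner_smul_right, h3, q₀]
  simp only [conj_trivial]
  ring

/-! ### Behaviour at $+\infty$ and integration of the logarithmic derivative -/

theorem tendsto_integral_Ioi_zero {E : Type*} [NormedAddCommGroup E] [NormedSpace ℝ E]
    {F : ℝ → E} (hi : ∀ s, IntegrableOn F (Ioi s)) :
    Tendsto (fun s => ∫ r in Ioi s, F r) atTop (nhds 0) := by
  have h := (intervalIntegral_tendsto_integral_Ioi 0 (hi 0) tendsto_id).const_sub
    (∫ r in Ioi (0 : ℝ), F r)
  rw [sub_self] at h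
  refine h.congr fun s => ?_
  rw [← intervalIntegral.integral_interval_add_Ioi (μ := volume) (hi 0) (hi s)]
  simp

/-- $K_s$ is the tail of a norm-convergent integral, and inversion is continuous at $1$. Only the
resulting boundedness is used, to make $u_0$ decay like $\|a_t\|^2$. -/
theorem tendsto_resolvent (hA : Admissible A) : Tendsto (resolvent hA) atTop (nhds 1) := by
  have h1 : Tendsto (fun s => 1 - kOp hA s) atTop (nhds (1 - 0)) := by
    refine tendsto_const_nhds.sub ?_
    exact (tendsto_integral_Ioi_zero (integrableOn_aRankOne hA)).congr fun s =>
      (kOp_eq_integral hA s).symm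
  rw [sub_zero] at h1
  have h2 := NormedRing.inverse_continuousAt (1 : (L2 →L[ℝ] L2)ˣ)
  rw [ContinuousAt, Units.val_one, Ring.inverse_one] at h2
  exact h2.comp h1

theorem integrableOn_u₀ (hA : Admissible A) (s : ℝ) : IntegrableOn (u₀ hA) (Ioi s) := by
  have hcont : Continuous (u₀ hA) :=
    continuous_iff_continuousAt.2 fun t => (hasDerivAt_u₀ hA t).continuousAt
  obtain ⟨C, c, hC, hc, hb⟩ := hA.exists_norm_aVec_le 0
  refine integrable_of_isBigO_exp_neg (b := c + c) (by positivity) hcont.continuousOn ?_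
  have hR : ∀ᶠ t in atTop, ‖resolvent hA t‖ < ‖(1 : L2 →L[ℝ] L2)‖ + 1 :=
    (tendsto_resolvent hA).norm.eventually_lt_const (by linarith)
  refine Asymptotics.IsBigO.of_bound (C * (‖(1 : L2 →L[ℝ] L2)‖ + 1) * C) ?_
  filter_upwards [hR, eventually_ge_atTop 0] with t h1 ht
  have h2 := hb t ht
  rw [sub_zero] at h2
  have h3 : ‖resolvent hA t (aVec hA t)‖ ≤
      (‖(1 : L2 →L[ℝ] L2)‖ + 1) * (C * Real.exp (-c * t)) :=
    (resolvent hA t).le_of_opNorm_le_of_le h1.le h2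
  refine (norm_inner_le_norm _ _).trans ((mul_le_mul h2 h3 (norm_nonneg _)
    (by positivity)).trans (le_of_eq ?_))
  rw [Real.norm_of_nonneg (Real.exp_pos _).le, show -(c + c) * t = -c * t + -c * t by ring,
    Real.exp_add]
  ring

theorem tendsto_fredholmDet (hA : Admissible A) :
    Tendsto (fun s => fredholmDet (kKernel A s)) atTop (nhds 1) := by
  obtain ⟨C, c, hC, hc, H⟩ := hA.exists_expBounded 0
  have hle : ∀ s, 0 ≤ s → C * Real.exp (-c * (s - 0)) ≤ C := fun s hs =>
    mul_le_of_le_one_right hC.le (Real.exp_le_one_iff.2 (by nlinarith))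
  have hlim : Tendsto (fun s => C * Real.exp (-c * (s - 0))) atTop (nhds 0) := by
    have h1 : Tendsto (fun s : ℝ => -c * (s - 0)) atTop atBot := by
      simpa using tendsto_id.const_mul_atTop_of_neg (show -c < 0 by linarith)
    simpa using (Real.tendsto_exp_atBot.comp h1).const_mul C
  have hterm : ∀ n : ℕ, Tendsto (fun s => fredholmTerm (kKernel A s) (n + 1)) atTop (nhds 0) := by
    intro n
    have h1 : Tendsto (fun s => (C * Real.exp (-c * (s - 0)) * c⁻¹ * √(n + 1 : ℕ)) ^ (n + 1) /
        ((n + 1).factorial : ℝ)) atTop (nhds 0) := by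
      have := (((hlim.mul_const c⁻¹).mul_const √(n + 1 : ℕ)).pow (n + 1)).div_const
        ((n + 1).factorial : ℝ)
      simpa using this
    refine squeeze_zero_norm' ?_ h1
    filter_upwards [eventually_ge_atTop 0] with s hs
    exact (H s hs).abs_fredholmTerm_le (n + 1)
  have hsum : Tendsto (fun s => ∑' n, fredholmTerm (kKernel A s) (n + 1)) atTop
      (nhds (∑' _n : ℕ, (0 : ℝ))) := by
    refine tendsto_tsum_of_dominated_convergence
      ((summable_nat_add_iff 1).2 (summable_hadamard (C * c⁻¹))) hterm ?_
    filter_upwards [eventually_ge_atTop 0] with s hs n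
    exact ((H s hs).mono (hle s hs)).abs_fredholmTerm_le (n + 1)
  rw [tsum_zero] at hsum
  simpa [fredholmDet, fredholmTerm] using hsum.const_add 1

/-- The product $\mathrm{Det}\cdot\exp\int_s^\infty u_0$ has zero derivative and limit $1$. Working
with the product instead of the logarithm makes positivity a consequence, not a prerequisite. -/
theorem fredholmDet_eq_exp (hA : Admissible A) (s : ℝ) :
    fredholmDet (kKernel A s) = Real.exp (-∫ t in Ioi s, u₀ hA t) := by
  have hcont : Continuous (u₀ hA) :=
    continuous_iff_continuousAt.2 fun t => (hasDerivAt_u₀ hA t).continuousAt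
  let Φ : ℝ → ℝ := fun s => fredholmDet (kKernel A s) * Real.exp (∫ t in Ioi s, u₀ hA t)
  have hΦ : ∀ s, HasDerivAt Φ 0 s := fun s => by
    refine ((hasDerivAt_fredholmDet hA s).mul
      (hasDerivAt_integral_Ioi hcont (integrableOn_u₀ hA) s).exp).congr_deriv ?_
    ring
  have hconst : ∀ t, Φ t = Φ s := fun t =>
    is_const_of_deriv_eq_zero (fun x => (hΦ x).differentiableAt) (fun x => (hΦ x).deriv) t s
  have hlim : Tendsto Φ atTop (nhds 1) := by
    have := (tendsto_fredholmDet hA).mul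
      (Real.continuous_exp.continuousAt.tendsto.comp
        (tendsto_integral_Ioi_zero (integrableOn_u₀ hA)))
    simpa using this
  have h1 : Φ s = 1 := tendsto_nhds_unique
    (tendsto_const_nhds.congr fun t => (hconst t).symm) hlim
  rw [Real.exp_neg]
  exact eq_inv_of_mul_eq_one_left h1

end TauRep

end

theorem mainTheorem2 (A : ℝ → ℝ) (hA : TauRep.Admissible A) :
    (∀ s : ℝ, IsUnit (1 - TauRep.kOp hA s) ∧
      TauRep.FredholmSeriesConverges (TauRep.kKernel A s) ∧
      0 < TauRep.fredholmDet (TauRep.kKernel A s)) ∧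
    (∀ s : ℝ,
      HasDerivAt (fun t : ℝ => Real.log (TauRep.fredholmDet (TauRep.kKernel A t)))
        (TauRep.u₀ hA s) s) ∧
    (∀ s : ℝ,
      HasDerivAt (deriv fun t : ℝ => Real.log (TauRep.fredholmDet (TauRep.kKernel A t)))
        (-(TauRep.q₀ hA s) ^ 2) s) ∧
    (∀ s : ℝ,
      MeasureTheory.IntegrableOn (TauRep.u₀ hA) (Set.Ioi s) ∧
      TauRep.fredholmDet (TauRep.kKernel A s) =
        Real.exp (-∫ t in Set.Ioi s, TauRep.u₀ hA t)) := by
  have hpos : ∀ s, 0 < TauRep.fredholmDet (TauRep.kKernel A s) := fun s => by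
    rw [TauRep.fredholmDet_eq_exp hA]
    exact Real.exp_pos _
  have hlog : ∀ s, HasDerivAt
      (fun t : ℝ => Real.log (TauRep.fredholmDet (TauRep.kKernel A t))) (TauRep.u₀ hA s) s :=
    fun s => ((TauRep.hasDerivAt_fredholmDet hA s).log (hpos s).ne').congr_deriv
      (mul_div_cancel_left₀ _ (hpos s).ne')
  refine ⟨fun s => ⟨TauRep.isUnit_one_sub_kOp hA s, ?_, hpos s⟩, hlog, fun s => ?_,
    fun s => ⟨TauRep.integrableOn_u₀ hA s, TauRep.fredholmDet_eq_exp hA s⟩⟩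
  · obtain ⟨C, c, hC, hc, H⟩ := hA.exists_expBounded s
    exact (H s le_rfl).fredholmSeriesConverges
  · rw [funext fun t => (hlog t).deriv]
    exact TauRep.hasDerivAt_u₀ hA s
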